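/- **Setting.** Fix integers $d,N$, a compact metrizable space $\Omega_0$, and let $\Omega=\Omega_0^{\mathbb Z^d}$ with the translations $(\tau_y\omega)_x=\omega_{x-y}$. Let $\mathbb P$ be a probability measure on $\Omega$ that is invariant and ergodic under $\tau$, has full support, and is invariant under all permutations of the coordinates. Let $\phi$ be a real antisymmetric $d\times d$ matrix. Write $C_N(X)=C(X,M_N(\mathbb C))$. Let $\mathcal A_d$ be the universal $C^*$-algebra generated by $C_N(\Omega)$ and unitaries $u_1,\dots,u_d$ with $$u_iu_j=e^{i\phi_{ij}}u_ju_i,\qquad f\,u_j=u_j\,(f\circ\tau_{e_j}),$$ and put $u_x=e^{-\frac i2\sum_{i<j}\phi_{ij}x_ix_j}u_1^{x_1}\cdots u_d^{x_d}$ for $x\in\mathbb Z^d$. For $L\in\mathbb N$ with $\phi_{ij}\in\frac{2\pi}{2L+1}\mathbb Z$ for all $i,j$ (an *admissible* $L$), let $V_L=\{-L,\dots,L\}^d$ and $\widehat\Omega=\Omega_0^{(\mathbb Z/(2L+1))^d}$ with its translations $\hat\tau$. Let $\hat{\mathcal A}_d$ be the universal $C^*$-algebra generated by $C_N(\widehat\Omega)$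 and unitaries $\hat u_j$ with the same relations (with $\hat\tau$ for $\tau$) and $\hat u_j^{2L+1}=1$; define $\hat u_x$ like $u_x$. Let $\widehat{\mathbb P}$ be the image of $\mathbb P$ under the restriction of $\omega$ to $V_L$, where $V_L$ is identified with $(\mathbb Z/(2L+1))^d$. For $a\in\mathcal A_d$, let $\hat a\in\hat{\mathcal A}_d$ be its image under the $*$-homomorphism that sends $u_j$ to $\hat u_j$ and $f\in C_N(\Omega)$ to $\hat\omega\mapsto f(\text{periodic extension of }\hat\omega)$. For $b\in\hat{\mathcal A}_d$, its Fourier coefficients $b_x\in C_N(\widehat\Omega)$, $x\in V_L$, are defined by $b=\sum_{x\in V_L}b_x\hat u_x$. Matrices carry the operator norm, $C_N$ the supremum norm, and $|x|$ is the Euclidean norm. **Hamiltonians.** Fix $\bar\omega\in\Omega$ with $\tau_x\bar\omega=\bar\omega$ for all $x$, a range $\mathcal R<\infty$ and matrices $w_x$, $|x|\le\mathcal R$, such that $h_0=\sum_{|x|\le\mathcal R}w_xu_x\in\mathcal A_d$ is self-adjoint. Consider self-adjoint $h=\sum_{|x|\le\mathcal R}h_xu_x\in\mathcal A_d$ with $h_x\in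 C_N(\Omega)$ and $h_x(\bar\omega)=w_x$, and put $\overline{\delta h}_x=\sup_{\omega\in\Omega}\|h_x(\omega)-h_x(\bar\omega)\|$. Fix $E\in\mathbb R$ with $\mathrm{dist}(E,\sigma(h_0))>0$. **Proposition.** For $s\in(0,1)$, say that $h$ satisfies the *Aizenman–Molchanov bound* at $(E,s)$ if there are $0<A_s,\gamma_s<\infty$ such that for all admissible $L$, all $z\in\mathbb C$ with $\mathrm{Re}\,z=E$ and $\mathrm{Im}\,z\ne0$, and all $x\in V_L$, the resolvent $(\hat h-z)^{-1}$ exists, has unique Fourier coefficients, and $$\int_{\widehat\Omega}d\widehat{\mathbb P}(\hat\omega)\,\big\|(\hat h-z)^{-1}_x(\hat\omega)\big\|^s\le A_s\,e^{-\gamma_s|x|}.$$ The bound holds when the fluctuations are small, in the following two senses: 1. There is $\varepsilon>0$ such that every $h$ as above with $\overline{\delta h}_x\le\varepsilon$ for all $x$ satisfies the Aizenman–Molchanov bound at $(E,s)$ for every $s\in(0,1)$. 2. If $h$ is as above, $s\in(0,1)$, and for some $\theta<1$ $$\Big(\sum_{x\in V_L}\big\|(\hat h_0-z)^{-1}_x\big\|^s\Big)\Big(\sum_{|x|\le\mathcal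 R}\big(\overline{\delta h}_x\big)^s\Big)\le\theta$$ for all admissible $L$ and all $z$ with $\mathrm{Re}\,z=E$, $\mathrm{Im}\,z\ne0$, then $h$ satisfies the Aizenman–Molchanov bound at $(E,s)$. -/

import Mathlib

open MeasureTheory
open scoped ENNReal Matrix.Norms.L2Operator

noncomputable section

universe u

namespace Brillouin

/-! ## Lattice notation -/

/-- The lattice `ℤ^d`. -/
abbrev Site (d : ℕ) : Type := Fin d → ℤ

/-- The finite torus `(ℤ / (2L+1)ℤ)^d`. -/
abbrev Torus (d L : ℕ) : Type := Fin d → ZMod (2 * L + 1)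

/-- The Euclidean length `|x|` of a lattice point. -/
def siteNorm {d : ℕ} (x : Site d) : ℝ := Real.sqrt (∑ i, (x i : ℝ) ^ 2)

/-- The super-cell `V_L = {-L, …, L}^d`. -/
def superCell (d L : ℕ) : Finset (Site d) :=
  Finset.Icc (fun _ => -(L : ℤ)) (fun _ => (L : ℤ))

/-- The class in the torus of a lattice point. -/
def siteClass {d : ℕ} (L : ℕ) (x : Site d) : Torus d L := fun i => (x i : ZMod (2 * L + 1))

/-- The representative in `V_L` of a point of the torus. -/
def siteLift {d L : ℕ} (x : Torus d L) : Site d := fun i => (x i).valMinAbs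

theorem siteClass_siteLift {d L : ℕ} (x : Torus d L) : siteClass L (siteLift x) = x := by
  funext i
  simp [siteClass, siteLift]

theorem siteLift_mem_superCell {d L : ℕ} (x : Torus d L) : siteLift x ∈ superCell d L := by
  have h : ∀ i, -(L : ℤ) ≤ (x i).valMinAbs ∧ (x i).valMinAbs ≤ (L : ℤ) := by
    intro i
    have h := ZMod.natAbs_valMinAbs_le (x i)
    omega
  exact Finset.mem_Icc.2 ⟨fun i => (h i).1, fun i => (h i).2⟩

/-! ## Universal `C⋆`-algebras of twisted crossed product type

Data: a compact space `X`, maps `τ_1, …, τ_d` of `X`, a real matrix `φ`, and a number `M`.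
The algebra is generated by a copy of `C(X, M_N(ℂ))` and by unitaries `u_1, …, u_d` with
`u_i u_j = exp(i φ_ij) u_j u_i`, `f u_j = u_j (f ∘ τ_j)` and `u_j ^ M = 1`.
The last relation is empty for `M = 0`. -/

/-- The `C⋆`-algebra `C_N(X)` of continuous functions with values in the `N × N` matrices with
the operator norm, equipped with the supremum norm. -/
abbrev MatFun (N : ℕ) (X : Type u) [TopologicalSpace X] : Type u :=
  C(X, Matrix (Fin N) (Fin N) ℂ)

section Algebra

variable {X : Type u} [TopologicalSpace X]

/-- A representation of the generators and relations on a nonzero Hilbert space. -/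
structure CovariantRep (N : ℕ) {d : ℕ} (τ : Fin d → C(X, X)) (φ : Matrix (Fin d) (Fin d) ℝ)
    (M : ℕ) : Type (u + 1) where
  /-- the Hilbert space -/
  H : Type u
  [normed : NormedAddCommGroup H]
  [inner : InnerProductSpace ℂ H]
  [complete : CompleteSpace H]
  [nontrivial : Nontrivial H]
  /-- the action of the functions -/
  π : MatFun N X →⋆ₐ[ℂ] (H →L[ℂ] H)
  /-- the operators that represent the generators `u_j` -/
  U : Fin d → H →L[ℂ] H
  U_mul_star : ∀ j, U j * star (U j) = 1
  star_mul_U : ∀ j, star (U j) * U j = 1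
  U_comm : ∀ i j, U i * U j = Complex.exp (Complex.I * (φ i j : ℂ)) • (U j * U i)
  covariant : ∀ j f, π f * U j = U j * π (f.comp (τ j))
  periodic : ∀ j, U j ^ M = 1

attribute [instance] CovariantRep.normed CovariantRep.inner CovariantRep.complete
  CovariantRep.nontrivial

variable (N : ℕ) {d : ℕ} (τ : Fin d → C(X, X)) (φ : Matrix (Fin d) (Fin d) ℝ) (M : ℕ)

/-- The `C⋆`-algebra of bounded families of operators, one for each representation. -/
abbrev BigProduct : Type (u + 1) :=
  lp (fun r : CovariantRep N τ φ M => r.H →L[ℂ] r.H) ∞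

variable {N τ φ M}

theorem CovariantRep.norm_U_le (r : CovariantRep N τ φ M) (j : Fin d) : ‖r.U j‖ ≤ 1 := by
  have h := CStarRing.norm_star_mul_self (x := r.U j)
  rw [r.star_mul_U j, norm_one] at h
  nlinarith [norm_nonneg (r.U j)]

variable (N τ φ M) [CompactSpace X]

/-- The family of all `π(f)`. -/
def genFun (f : MatFun N X) : BigProduct N τ φ M :=
  ⟨fun r => r.π f, memℓp_infty ⟨‖f‖, by
    rintro _ ⟨r, rfl⟩
    exact NonUnitalStarAlgHom.norm_apply_le r.π f⟩⟩

/-- The family of all `U_j`. -/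
def genU (j : Fin d) : BigProduct N τ φ M :=
  ⟨fun r => r.U j, memℓp_infty ⟨1, by
    rintro _ ⟨r, rfl⟩
    exact r.norm_U_le j⟩⟩

/-- The universal `C⋆`-algebra of the relations: the closed `⋆`-algebra generated by the families
of all `π(f)` and all `U_j`. Its norm is the supremum of the norms in all representations. -/
def universalAlgebra : StarSubalgebra ℂ (BigProduct N τ φ M) :=
  (StarAlgebra.adjoin ℂ
    (Set.range (genFun N τ φ M) ∪ Set.range (genU N τ φ M))).topologicalClosure

/-- The universal `C⋆`-algebra as a type. -/
def UnivAlg : Type (u + 1) := ↥(universalAlgebra N τ φ M)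

instance : IsClosed (universalAlgebra N τ φ M : Set (BigProduct N τ φ M)) :=
  StarSubalgebra.isClosed_topologicalClosure _

instance : CStarAlgebra (BigProduct N τ φ M) where

instance : CStarAlgebra (UnivAlg N τ φ M) :=
  inferInstanceAs (CStarAlgebra ↥(universalAlgebra N τ φ M))

theorem genFun_mem (f : MatFun N X) : genFun N τ φ M f ∈ universalAlgebra N τ φ M :=
  StarSubalgebra.le_topologicalClosure _ (StarAlgebra.subset_adjoin ℂ _ (Or.inl ⟨f, rfl⟩))

theorem genU_mem (j : Fin d) : genU N τ φ M j ∈ universalAlgebra N τ φ M :=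
  StarSubalgebra.le_topologicalClosure _ (StarAlgebra.subset_adjoin ℂ _ (Or.inr ⟨j, rfl⟩))

/-- The embedding of the functions into the universal algebra. -/
def ofFun : MatFun N X →⋆ₐ[ℂ] UnivAlg N τ φ M where
  toFun f := ⟨genFun N τ φ M f, genFun_mem N τ φ M f⟩
  map_one' := by apply Subtype.ext; apply Subtype.ext; funext r; exact map_one r.π
  map_mul' f g := by apply Subtype.ext; apply Subtype.ext; funext r; exact map_mul r.π f g
  map_zero' := by apply Subtype.ext; apply Subtype.ext; funext r; exact map_zero r.π
  map_add' f g := by apply Subtype.ext; apply Subtype.ext; funext r; exact map_add r.π f g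
  commutes' z := by
    apply Subtype.ext; apply Subtype.ext; funext r; exact AlgHomClass.commutes r.π z
  map_star' f := by apply Subtype.ext; apply Subtype.ext; funext r; exact map_star r.π f

/-- The generator `u_j` of the universal algebra. -/
def genElem (j : Fin d) : UnivAlg N τ φ M := ⟨genU N τ φ M j, genU_mem N τ φ M j⟩

/-- The generator `u_j` as a unitary element. -/
def gen (j : Fin d) : unitary (UnivAlg N τ φ M) :=
  ⟨genElem N τ φ M j, Unitary.mem_iff.2 ⟨
    Subtype.ext (Subtype.ext (funext fun r => r.star_mul_U j)),
    Subtype.ext (Subtype.ext (funext fun r => r.U_mul_star j))⟩⟩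

/-- The symmetric monomials
`u_x = exp(-(i/2) ∑_{i<j} φ_ij x_i x_j) u_1^{x_1} ⋯ u_d^{x_d}`. -/
def monomial (x : Site d) : UnivAlg N τ φ M :=
  Complex.exp (-(Complex.I / 2) *
      ((∑ i, ∑ j ∈ Finset.Ioi i, φ i j * (x i : ℝ) * (x j : ℝ) : ℝ) : ℂ)) •
    (((List.ofFn fun j => gen N τ φ M j ^ x j).prod : unitary (UnivAlg N τ φ M)) :
      UnivAlg N τ φ M)

/-- The element `∑ a_x u_x` with finitely many nonzero coefficients `a_x`. -/
def polynomial (a : Site d →₀ MatFun N X) : UnivAlg N τ φ M :=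
  a.sum fun x f => ofFun N τ φ M f * monomial N τ φ M x

end Algebra

section Functoriality

variable {X Y : Type u} [TopologicalSpace X] [TopologicalSpace Y]
  (N : ℕ) {d : ℕ} {τ : Fin d → C(X, X)} {σ : Fin d → C(Y, Y)} (φ : Matrix (Fin d) (Fin d) ℝ)
  {M M' : ℕ}

/-- Restriction of functions along an equivariant map `F : Y → X` turns representations of the
relations over `Y` into representations of the relations over `X`. -/
def CovariantRep.pullback {N : ℕ} {φ : Matrix (Fin d) (Fin d) ℝ} (F : C(Y, X))
    (hF : ∀ j, F.comp (σ j) = (τ j).comp F) (hM : M' ∣ M) (r : CovariantRep N σ φ M') :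
    CovariantRep N τ φ M where
  H := r.H
  π := r.π.comp (ContinuousMap.compStarAlgHom' ℂ _ F)
  U := r.U
  U_mul_star := r.U_mul_star
  star_mul_U := r.star_mul_U
  U_comm := r.U_comm
  covariant j f := by
    have h := r.covariant j (f.comp F)
    rw [ContinuousMap.comp_assoc, hF j, ← ContinuousMap.comp_assoc] at h
    exact h
  periodic j := by
    obtain ⟨k, rfl⟩ := hM
    rw [pow_mul, r.periodic j, one_pow]

/-- The induced map between the algebras of bounded families. -/
def bigProductMap (F : C(Y, X)) (hF : ∀ j, F.comp (σ j) = (τ j).comp F) (hM : M' ∣ M) :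
    BigProduct N τ φ M →⋆ₐ[ℂ] BigProduct N σ φ M' where
  toFun T := ⟨fun r => T (r.pullback F hF hM), memℓp_infty (by
    obtain ⟨C, hC⟩ := memℓp_infty_iff.1 (lp.memℓp T)
    exact ⟨C, by rintro _ ⟨r, rfl⟩; exact hC ⟨r.pullback F hF hM, rfl⟩⟩)⟩
  map_one' := rfl
  map_mul' _ _ := rfl
  map_zero' := rfl
  map_add' _ _ := rfl
  commutes' _ := rfl
  map_star' _ := rfl

theorem bigProductMap_continuous (F : C(Y, X)) (hF : ∀ j, F.comp (σ j) = (τ j).comp F)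
    (hM : M' ∣ M) : Continuous (bigProductMap N φ F hF hM) := by
  refine AddMonoidHomClass.continuous_of_bound (bigProductMap N φ F hF hM) 1 fun T => ?_
  rw [one_mul]
  refine lp.norm_le_of_forall_le (norm_nonneg T) fun r => ?_
  exact lp.norm_apply_le_norm ENNReal.top_ne_zero T (r.pullback F hF hM)

variable [CompactSpace X] [CompactSpace Y]

theorem bigProductMap_mem (F : C(Y, X)) (hF : ∀ j, F.comp (σ j) = (τ j).comp F) (hM : M' ∣ M)
    (a : universalAlgebra N τ φ M) :
    bigProductMap N φ F hF hM a ∈ universalAlgebra N σ φ M' := by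
  have hle : universalAlgebra N τ φ M ≤
      (universalAlgebra N σ φ M').comap (bigProductMap N φ F hF hM) := by
    refine StarSubalgebra.topologicalClosure_minimal (StarAlgebra.adjoin_le ?_) ?_
    · rintro _ (⟨f, rfl⟩ | ⟨j, rfl⟩)
      · exact genFun_mem N σ φ M' (f.comp F)
      · exact genU_mem N σ φ M' j
    · exact (StarSubalgebra.isClosed_topologicalClosure _).preimage
        (bigProductMap_continuous N φ F hF hM)
  exact hle a.2

/-- The `⋆`-homomorphism of universal algebras with `f ↦ f ∘ F` and `u_j ↦ u_j`. -/
def inducedHom (F : C(Y, X)) (hF : ∀ j, F.comp (σ j) = (τ j).comp F) (hM : M' ∣ M) :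
    UnivAlg N τ φ M →⋆ₐ[ℂ] UnivAlg N σ φ M' where
  toFun a := ⟨bigProductMap N φ F hF hM a.1, bigProductMap_mem N φ F hF hM a⟩
  map_one' := rfl
  map_mul' _ _ := rfl
  map_zero' := rfl
  map_add' _ _ := rfl
  commutes' _ := rfl
  map_star' _ := rfl

theorem inducedHom_ofFun (F : C(Y, X)) (hF : ∀ j, F.comp (σ j) = (τ j).comp F) (hM : M' ∣ M)
    (f : MatFun N X) :
    inducedHom N φ F hF hM (ofFun N τ φ M f) = ofFun N σ φ M' (f.comp F) := rfl

theorem inducedHom_gen (F : C(Y, X)) (hF : ∀ j, F.comp (σ j) = (τ j).comp F) (hM : M' ∣ M)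
    (j : Fin d) :
    inducedHom N φ F hF hM (gen N τ φ M j : UnivAlg N τ φ M) = gen N σ φ M' j := rfl

end Functoriality

/-! ## Disorder configurations -/

section Disorder

variable (d : ℕ) (Ω₀ : Type u) [TopologicalSpace Ω₀]

/-- The space `Ω` of disorder configurations. -/
abbrev Config : Type u := Site d → Ω₀

/-- The finite-volume disorder configurations, indexed by the torus. -/
abbrev FiniteConfig (L : ℕ) : Type u := Torus d L → Ω₀

variable {d Ω₀}

/-- The translation `(τ_y ω)_x = ω_{x-y}`, on any index group. -/
def shift {G : Type*} [AddGroup G] (y : G) : C(G → Ω₀, G → Ω₀) where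
  toFun ω x := ω (x - y)
  continuous_toFun := by fun_prop

variable (d Ω₀)

/-- The generators of the translations of `Ω`. -/
def shiftGen (j : Fin d) : C(Config d Ω₀, Config d Ω₀) := shift (Pi.single j 1)

/-- The generators of the translations of the finite-volume configurations. -/
def finiteShiftGen (L : ℕ) (j : Fin d) : C(FiniteConfig d Ω₀ L, FiniteConfig d Ω₀ L) :=
  shift (Pi.single j 1)

/-- The `(2L+1)`-periodic disorder configurations. -/
def PeriodicConfig (L : ℕ) : Set (Config d Ω₀) :=
  {ω | ∀ j, (shiftGen d Ω₀ j)^[2 * L + 1] ω = ω}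

variable {d Ω₀}

theorem shiftGen_iterate (j : Fin d) (n : ℕ) (ω : Config d Ω₀) (x : Site d) :
    (shiftGen d Ω₀ j)^[n] ω x = ω (x - n • Pi.single j 1) := by
  induction n generalizing ω with
  | zero => simp
  | succ n ih =>
    rw [Function.iterate_succ_apply, ih]
    change ω (_ - _) = _
    rw [succ_nsmul, sub_sub]

theorem mem_periodicConfig_iff {L : ℕ} {ω : Config d Ω₀} :
    ω ∈ PeriodicConfig d Ω₀ L ↔ ∀ j x, ω (x - (2 * L + 1) • Pi.single j 1) = ω x := by
  simp only [PeriodicConfig, Set.mem_ofPred_eq, funext_iff, shiftGen_iterate]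

theorem shiftGen_mem_periodicConfig {L : ℕ} (j : Fin d) {ω : Config d Ω₀}
    (hω : ω ∈ PeriodicConfig d Ω₀ L) : shiftGen d Ω₀ j ω ∈ PeriodicConfig d Ω₀ L := by
  rw [mem_periodicConfig_iff] at hω ⊢
  intro i x
  change ω (_ - _) = ω (_ - _)
  rw [sub_right_comm]
  exact hω i _

theorem isClosed_periodicConfig [T2Space Ω₀] (L : ℕ) : IsClosed (PeriodicConfig d Ω₀ L) := by
  simp only [PeriodicConfig, Set.ofPred_forall]
  exact isClosed_iInter fun j =>
    isClosed_eq ((shiftGen d Ω₀ j).continuous.iterate _) continuous_id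

instance [T2Space Ω₀] [CompactSpace Ω₀] (L : ℕ) : CompactSpace (PeriodicConfig d Ω₀ L) :=
  isCompact_iff_compactSpace.1 (isClosed_periodicConfig L).isCompact

variable (d Ω₀)

/-- The generators of the translations of the periodic configurations. -/
def periodicShiftGen (L : ℕ) (j : Fin d) : C(PeriodicConfig d Ω₀ L, PeriodicConfig d Ω₀ L) where
  toFun ω := ⟨shiftGen d Ω₀ j ω, shiftGen_mem_periodicConfig j ω.2⟩
  continuous_toFun := by fun_prop

variable {d Ω₀}

theorem siteClass_sub_period {L : ℕ} (x : Site d) (j : Fin d) :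
    siteClass L (x - (2 * L + 1) • Pi.single j 1) = siteClass L x := by
  funext i
  have h : ((2 * L + 1 : ℕ) : ZMod (2 * L + 1)) = 0 := ZMod.natCast_self _
  have h' : (2 * (L : ZMod (2 * L + 1)) + 1) = 0 := by exact_mod_cast h
  simp [siteClass, h']

/-- A function on the torus, seen as a periodic function on the lattice. -/
theorem comp_siteClass_mem {L : ℕ} (ω : FiniteConfig d Ω₀ L) :
    (fun x => ω (siteClass L x)) ∈ PeriodicConfig d Ω₀ L := by
  rw [mem_periodicConfig_iff]
  intro j x
  simp only [siteClass_sub_period]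

/-- The map `Ω → Ω̃`: the unique periodic configuration that agrees with `ω` on `V_L`. -/
def periodize (L : ℕ) (ω : Config d Ω₀) : PeriodicConfig d Ω₀ L :=
  ⟨fun x => ω (siteLift (siteClass L x)), comp_siteClass_mem fun x => ω (siteLift x)⟩

/-- The map `Ω̃ → Ω̂`, `(q̂ ω)_x̂ = ω_{s(x̂)}`. -/
def toFinite (L : ℕ) (ω : PeriodicConfig d Ω₀ L) : FiniteConfig d Ω₀ L :=
  fun x => ω.1 (siteLift x)

/-- The inverse map `Ω̂ → Ω̃`. -/
def ofFinite (L : ℕ) : C(FiniteConfig d Ω₀ L, PeriodicConfig d Ω₀ L) where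
  toFun ω := ⟨fun x => ω (siteClass L x), comp_siteClass_mem ω⟩
  continuous_toFun := by fun_prop

theorem toFinite_ofFinite (L : ℕ) (ω : FiniteConfig d Ω₀ L) :
    toFinite L (ofFinite L ω) = ω := by
  funext x
  change ω (siteClass L (siteLift x)) = ω x
  rw [siteClass_siteLift]

/-- The inclusion `Ω̃ → Ω`. -/
def periodicIncl (L : ℕ) : C(PeriodicConfig d Ω₀ L, Config d Ω₀) := ⟨Subtype.val, by fun_prop⟩

theorem periodicIncl_equivariant (L : ℕ) (j : Fin d) :
    (periodicIncl L).comp (periodicShiftGen d Ω₀ L j) =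
      (shiftGen d Ω₀ j).comp (periodicIncl L) := rfl

theorem ofFinite_equivariant (L : ℕ) (j : Fin d) :
    (ofFinite L).comp (finiteShiftGen d Ω₀ L j) =
      (periodicShiftGen d Ω₀ L j).comp (ofFinite L) := by
  apply ContinuousMap.ext; intro ω; apply Subtype.ext; funext x
  change ω (siteClass L x - Pi.single j 1) = ω (siteClass L (x - Pi.single j 1))
  congr 1
  funext i
  by_cases h : i = j
  · subst h; simp [siteClass]
  · simp [siteClass, h]

end Disorder

/-! ## The three algebras, the two epimorphisms and the finite-volume approximation -/

section Observables

variable {d : ℕ} (N : ℕ) (Ω₀ : Type u) [TopologicalSpace Ω₀] [CompactSpace Ω₀] [T2Space Ω₀]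
  (φ : Matrix (Fin d) (Fin d) ℝ)

/-- The algebra `𝒜_d` of bulk observables. -/
abbrev BulkAlgebra : Type (u + 1) :=
  UnivAlg N (shiftGen d Ω₀) φ 0

/-- The periodic algebra. -/
abbrev PeriodicAlgebra (L : ℕ) : Type (u + 1) :=
  UnivAlg N (periodicShiftGen d Ω₀ L) φ 0

/-- The finite-volume algebra; its generators satisfy in addition `û_j^{2L+1} = 1`. -/
abbrev FiniteAlgebra (L : ℕ) : Type (u + 1) :=
  UnivAlg N (finiteShiftGen d Ω₀ L) φ (2 * L + 1)

/-- The epimorphism `𝒜_d → 𝒜̃_d`. -/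
def toPeriodic (L : ℕ) : BulkAlgebra N Ω₀ φ →⋆ₐ[ℂ] PeriodicAlgebra N Ω₀ φ L :=
  inducedHom N φ (periodicIncl L) (periodicIncl_equivariant L) (dvd_refl 0)

/-- The epimorphism `𝒜̃_d → 𝒜̂_d`. -/
def periodicToFinite (L : ℕ) : PeriodicAlgebra N Ω₀ φ L →⋆ₐ[ℂ] FiniteAlgebra N Ω₀ φ L :=
  inducedHom N φ (ofFinite L) (ofFinite_equivariant L) (dvd_zero (2 * L + 1))

variable {N Ω₀}

/-- The element `h = ∑ h_x u_x` of `𝒜_d` with finitely many Fourier coefficients. -/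
def bulk (h : Site d →₀ MatFun N (Config d Ω₀)) : BulkAlgebra N Ω₀ φ :=
  polynomial N (shiftGen d Ω₀) φ 0 h

/-- The finite-volume periodic approximation `ĥ` of `h`. -/
def finiteVolume (L : ℕ) (a : BulkAlgebra N Ω₀ φ) : FiniteAlgebra N Ω₀ φ L :=
  periodicToFinite N Ω₀ φ L (toPeriodic N Ω₀ φ L a)

/-- The resolvent `(a - z)⁻¹` in the finite-volume algebra. -/
def finiteResolvent (L : ℕ) (a : FiniteAlgebra N Ω₀ φ L) (z : ℂ) : FiniteAlgebra N Ω₀ φ L :=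
  Ring.inverse (a - algebraMap ℂ (FiniteAlgebra N Ω₀ φ L) z)

/-- The functions `c_x`, `x ∈ V_L`, are Fourier coefficients of `a`: `a = ∑_{x ∈ V_L} c_x û_x`. -/
def IsFourierExpansion (L : ℕ) (a : FiniteAlgebra N Ω₀ φ L)
    (c : superCell d L → MatFun N (FiniteConfig d Ω₀ L)) : Prop :=
  a = ∑ x, ofFun N (finiteShiftGen d Ω₀ L) φ (2 * L + 1) (c x) *
    monomial N (finiteShiftGen d Ω₀ L) φ (2 * L + 1) x.1

/-- The flux matrix is compatible with the super-cell `V_L`: `φ_ij ∈ (2π / (2L+1)) ℤ`. -/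
def FluxQuantized (L : ℕ) : Prop :=
  ∀ i j, ∃ n : ℤ, φ i j = 2 * n * Real.pi / (2 * L + 1)

end Observables

/-! ## Measures and the Aizenman–Molchanov bound -/

section Measures

variable {d : ℕ} {Ω₀ : Type u} [TopologicalSpace Ω₀] [MeasurableSpace Ω₀]

/-- The standing assumptions on the law of the disorder. -/
structure IsDisorderMeasure (P : Measure (Config d Ω₀)) : Prop where
  isProbability : IsProbabilityMeasure P
  invariant : ∀ y : Site d, P.map (shift y) = P
  ergodic : ∀ s : Set (Config d Ω₀), MeasurableSet s →
    (∀ y : Site d, shift y ⁻¹' s = s) → P s = 0 ∨ P sᶜ = 0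
  fullSupport : P.IsOpenPosMeasure
  exchangeable : ∀ r : Equiv.Perm (Site d), P.map (fun ω x => ω (r x)) = P

/-- The push-forward of the law to the finite-volume configurations. -/
def finiteMeasure (P : Measure (Config d Ω₀)) (L : ℕ) : Measure (FiniteConfig d Ω₀ L) :=
  (P.map (periodize L)).map (toFinite L)

theorem measurable_periodize (L : ℕ) : Measurable (periodize (d := d) (Ω₀ := Ω₀) L) :=
  Measurable.subtype_mk (measurable_pi_lambda _ fun _ => measurable_pi_apply _)

theorem measurable_toFinite (L : ℕ) : Measurable (toFinite (d := d) (Ω₀ := Ω₀) L) :=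
  measurable_pi_lambda _ fun _ => (measurable_pi_apply _).comp measurable_subtype_coe

/-- The Aizenman–Molchanov bound for the finite-volume approximations of `h = ∑ h_x u_x`
at the energy `E` and the power `s`, uniformly in the size `L` and in the imaginary part `η`. -/
def AizenmanMolchanovBound {N : ℕ} [CompactSpace Ω₀] [T2Space Ω₀]
    (φ : Matrix (Fin d) (Fin d) ℝ) (P : Measure (Config d Ω₀))
    (h : Site d →₀ MatFun N (Config d Ω₀)) (E s : ℝ) : Prop :=
  ∃ A : ℝ, 0 < A ∧ ∃ γ : ℝ, 0 < γ ∧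
    ∀ L : ℕ, FluxQuantized φ L → ∀ η : ℝ, η ≠ 0 →
      IsUnit (finiteVolume φ L (bulk φ h) -
        algebraMap ℂ (FiniteAlgebra N Ω₀ φ L) (E + η * Complex.I)) ∧
      ∃ G : superCell d L → MatFun N (FiniteConfig d Ω₀ L),
        (∀ G', IsFourierExpansion φ L
          (finiteResolvent φ L (finiteVolume φ L (bulk φ h)) (E + η * Complex.I)) G' ↔ G' = G) ∧
        ∀ x, ∫ ω, ‖G x ω‖ ^ s ∂(finiteMeasure P L) ≤ A * Real.exp (-γ * siteNorm x.1)

end Measures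

/-- The non-random coefficients of a translation-invariant reference element, seen as constant
functions. -/
def constCoeff {d N : ℕ} (X : Type u) [TopologicalSpace X]
    (w : Site d →₀ Matrix (Fin N) (Fin N) ℂ) : Site d →₀ MatFun N X :=
  w.mapRange (ContinuousMap.const X) rfl

end Brillouin

end

open MeasureTheory Brillouin

noncomputable section

universe u

open scoped Pointwise Kronecker

/-! The bound is deterministic: small fluctuations do not close the spectral gap of `h₀` at `E`, and
inside a gap the resolvent coefficients decay exponentially for every configuration. Integrating
against a probability measure preserves such a bound.

Gap. Homomorphisms shrink spectra, so every finite-volume `ĥ₀` inherits the gap `g` of `h₀`,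
uniformly in `L`. If `‖(ĥ₀ - z)⁻¹‖ ‖h - h₀‖ ≤ θ < 1` for all `z = E + iη` with `η ≠ 0`, a Neumann
series shows that `ĥ` keeps a gap `g (1 - θ)` (`IsSelfAdjoint.gap_add`). In the first assertion
`‖(ĥ₀ - z)⁻¹‖ ≤ 1/g`, and `‖h - h₀‖` is at most a number of sites, fixed by the range, times `ε`. In
the second, both norms are at most the sums of the norms of the coefficients, and `(∑ f)^s ≤ ∑ f^s`
gives the product bound `θ^(1/s) < 1`.

Decay. Put `T = 1 - |h - z|² / (a² + η²)` with `a ≥ ‖h‖ + |E|` and `a > g`. The spectral theorem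
gives `‖T‖ ≤ q = 1 - g²/a² < 1` for all `η`, while `(h - z)⁻¹ (1 - Tⁿ)` is a polynomial in `h`, of
range at most `2rn` if `h` has range `r`. A coefficient beyond that range sees only `(h - z)⁻¹ Tⁿ`,
of norm at most `qⁿ/g`. Taking `n` proportional to `|x|` gives the decay
(`norm_resolvent_coeff_le`).

Coefficients. Both steps need unique coefficients controlled by the norm. For quantised flux the
finite-volume algebra acts on `ℂ^N ⊗ ℓ²(torus)` by magnetic translations, and up to a phase each
coefficient is a matrix block of this representation. So the coefficient map is bounded below, hence
injective with closed range, and a density argument makes it surjective (`fourierSum_injective`,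
`fourierSum_surjective`). -/

/-! ### Words in the generators, up to phases, and the span of the elements `f u_y`. -/

theorem List.prod_ofFn_zpow_add {G : Type*} [Group G] {n : ℕ} (g : Fin n → G)
    (hg : ∀ i j, Commute (g i) (g j)) (x y : Fin n → ℤ) :
    (List.ofFn fun j => g j ^ x j).prod * (List.ofFn fun j => g j ^ y j).prod =
      (List.ofFn fun j => g j ^ (x + y) j).prod := by
  induction n with
  | zero => simp
  | succ n ih =>
    simp only [List.ofFn_succ, List.prod_cons]
    have h := ih (fun j => g j.succ) (fun i j => hg _ _) (fun j => x j.succ) (fun j => y j.succ)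
    have hc : Commute ((List.ofFn fun j : Fin n => g j.succ ^ x j.succ).prod) (g 0 ^ y 0) := by
      refine Commute.list_prod_left _ _ fun a ha => ?_
      obtain ⟨j, rfl⟩ := List.mem_ofFn.1 ha
      exact ((hg _ _).zpow_left _).zpow_right _
    rw [mul_assoc, ← mul_assoc _ (g 0 ^ y 0), hc.eq, mul_assoc, h, ← mul_assoc, ← zpow_add]
    rfl

/-- The scalars of modulus one in the unitary group of a complex algebra. -/
def unitScalars (A : Type*) [CStarAlgebra A] : Subgroup (unitary A) where
  carrier := {v | ∃ c : ℂ, ‖c‖ = 1 ∧ (v : A) = c • 1}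
  one_mem' := ⟨1, by simp, by simp⟩
  mul_mem' := by
    rintro a b ⟨c, hc, ha⟩ ⟨e, he, hb⟩
    exact ⟨c * e, by simp [hc, he], by simp [ha, hb, smul_smul, mul_comm]⟩
  inv_mem' := by
    rintro a ⟨c, hc, ha⟩
    exact ⟨star c, by simp [hc], by rw [← Unitary.star_eq_inv, Unitary.coe_star, ha]; simp⟩

instance (A : Type*) [CStarAlgebra A] : (unitScalars A).Normal where
  conj_mem := by
    rintro v ⟨c, hc, hv⟩ g
    refine ⟨c, hc, ?_⟩
    have : (g : A) * ((g⁻¹ : unitary A) : A) = 1 := by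
      rw [← Submonoid.coe_mul, mul_inv_cancel, Submonoid.coe_one]
    simp [hv, this]

theorem exists_smul_of_mk_eq {A : Type*} [CStarAlgebra A] {v w : unitary A}
    (h : (QuotientGroup.mk v : unitary A ⧸ unitScalars A) = QuotientGroup.mk w) :
    ∃ c : ℂ, ‖c‖ = 1 ∧ (w : A) = c • (v : A) := by
  obtain ⟨c, hc, h⟩ := QuotientGroup.eq.1 h
  refine ⟨c, hc, ?_⟩
  calc (w : A) = (v * (v⁻¹ * w) : unitary A) := by rw [mul_inv_cancel_left]
    _ = (v : A) * (v⁻¹ * w : unitary A) := rfl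
    _ = c • (v : A) := by rw [h]; simp

namespace Brillouin

section Algebra

variable {X : Type u} [TopologicalSpace X] [CompactSpace X] {N : ℕ} {d : ℕ} {τ : Fin d → C(X, X)}
  {φ : Matrix (Fin d) (Fin d) ℝ} {M : ℕ}

/-- The evaluation of the universal algebra in a representation. -/
def evalRep (r : CovariantRep N τ φ M) : UnivAlg N τ φ M →⋆ₐ[ℂ] (r.H →L[ℂ] r.H) where
  toFun a := a.1 r
  map_one' := rfl
  map_mul' _ _ := rfl
  map_zero' := rfl
  map_add' _ _ := rfl
  commutes' _ := rfl
  map_star' _ := rfl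

variable (N τ φ M) in
/-- The ordered monomials `u_1^{x_1} ⋯ u_d^{x_d}`. -/
def word (x : Site d) : unitary (UnivAlg N τ φ M) :=
  (List.ofFn fun j => gen N τ φ M j ^ x j).prod

theorem monomial_eq_smul_word (x : Site d) :
    ∃ c : ℂ, ‖c‖ = 1 ∧ monomial N τ φ M x = c • (word N τ φ M x : UnivAlg N τ φ M) := by
  refine ⟨_, ?_, rfl⟩
  rw [Complex.norm_exp, Real.exp_eq_one_iff]
  simp [Complex.mul_re]

theorem norm_word_le (x : Site d) : ‖(word N τ φ M x : UnivAlg N τ φ M)‖ ≤ 1 := by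
  cases subsingleton_or_nontrivial (UnivAlg N τ φ M)
  · rw [Subsingleton.elim (word N τ φ M x : UnivAlg N τ φ M) 0]; simp
  · exact (CStarRing.norm_coe_unitary _).le

theorem norm_monomial_le (x : Site d) : ‖monomial N τ φ M x‖ ≤ 1 := by
  obtain ⟨c, hc, h⟩ := monomial_eq_smul_word (N := N) (τ := τ) (φ := φ) (M := M) x
  rw [h, norm_smul, hc, one_mul]
  exact norm_word_le x

theorem norm_ofFun_le (f : MatFun N X) : ‖ofFun N τ φ M f‖ ≤ ‖f‖ :=
  NonUnitalStarAlgHom.norm_apply_le (ofFun N τ φ M) f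

theorem genElem_mul (i j : Fin d) :
    genElem N τ φ M i * genElem N τ φ M j =
      Complex.exp (Complex.I * (φ i j : ℂ)) • (genElem N τ φ M j * genElem N τ φ M i) :=
  Subtype.ext (Subtype.ext (funext fun r => r.U_comm i j))

theorem ofFun_mul_genElem (f : MatFun N X) (j : Fin d) :
    ofFun N τ φ M f * genElem N τ φ M j = genElem N τ φ M j * ofFun N τ φ M (f.comp (τ j)) :=
  Subtype.ext (Subtype.ext (funext fun r => r.covariant j f))

theorem gen_pow (j : Fin d) : gen N τ φ M j ^ M = 1 := by
  have h : genElem N τ φ M j ^ M = 1 :=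
    Subtype.ext (Subtype.ext (funext fun r => by
      have := r.periodic j
      change (genU N τ φ M j ^ M : BigProduct N τ φ M) r = 1
      rw [lp.infty_coeFn_pow]
      exact this))
  exact Subtype.ext h

/-- Modulo unimodular scalars the twisted relations become plain commutation. Words then multiply
like lattice points, and the phases, irrelevant for norms and spans, need not be tracked. -/
theorem mk_gen_commute (i j : Fin d) :
    Commute (QuotientGroup.mk (gen N τ φ M i) : _ ⧸ unitScalars (UnivAlg N τ φ M))
      (QuotientGroup.mk (gen N τ φ M j)) := by
  rw [Commute, SemiconjBy, ← QuotientGroup.mk_mul, ← QuotientGroup.mk_mul, eq_comm,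
    QuotientGroup.eq]
  refine ⟨Complex.exp (Complex.I * (φ i j : ℂ)), ?_, ?_⟩
  · rw [Complex.norm_exp]; simp
  · have h := genElem_mul (N := N) (τ := τ) (φ := φ) (M := M) i j
    have h2 : (((gen N τ φ M j * gen N τ φ M i)⁻¹ : unitary _) : UnivAlg N τ φ M) *
        ((gen N τ φ M j * gen N τ φ M i : unitary _) : UnivAlg N τ φ M) = 1 := by
      rw [← Submonoid.coe_mul, inv_mul_cancel, Submonoid.coe_one]
    change _ * (genElem N τ φ M i * genElem N τ φ M j) = _
    rw [h, mul_smul_comm]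
    exact congrArg _ h2

theorem mk_word (x : Site d) :
    (QuotientGroup.mk (word N τ φ M x) : _ ⧸ unitScalars (UnivAlg N τ φ M)) =
      (List.ofFn fun j => (QuotientGroup.mk (gen N τ φ M j) :
        _ ⧸ unitScalars (UnivAlg N τ φ M)) ^ x j).prod := by
  change QuotientGroup.mk' _ _ = _
  rw [word, map_list_prod, List.map_ofFn]
  rfl

theorem word_mul_word (x y : Site d) : ∃ c : ℂ, ‖c‖ = 1 ∧
    (word N τ φ M x : UnivAlg N τ φ M) * word N τ φ M y = c • word N τ φ M (x + y) := by
  refine exists_smul_of_mk_eq (v := word N τ φ M (x + y))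
    (w := word N τ φ M x * word N τ φ M y) ?_
  rw [QuotientGroup.mk_mul, mk_word, mk_word, mk_word,
    List.prod_ofFn_zpow_add _ fun i j => mk_gen_commute i j]

theorem word_zero : word N τ φ M 0 = 1 := by
  simp [word, List.ofFn_const]

theorem star_word (x : Site d) : ∃ c : ℂ, ‖c‖ = 1 ∧
    star (word N τ φ M x : UnivAlg N τ φ M) = c • word N τ φ M (-x) := by
  refine exists_smul_of_mk_eq (v := word N τ φ M (-x)) (w := star (word N τ φ M x)) ?_
  rw [Unitary.star_eq_inv, QuotientGroup.mk_inv, eq_comm, inv_eq_iff_mul_eq_one, mk_word, mk_word,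
    List.prod_ofFn_zpow_add _ fun i j => mk_gen_commute i j]
  simp [List.ofFn_const]

theorem word_congr {x y : Site d} (h : ∀ j, (M : ℤ) ∣ x j - y j) :
    word N τ φ M x = word N τ φ M y := by
  unfold word
  congr 2
  funext j
  obtain ⟨k, hk⟩ := h j
  rw [show x j = y j + M * k by omega, zpow_add, zpow_mul, zpow_natCast, gen_pow, one_zpow,
    mul_one]

theorem word_single (j : Fin d) : word N τ φ M (Pi.single j 1) = gen N τ φ M j := by
  unfold word
  have h : (fun i => gen N τ φ M i ^ (Pi.single j 1 : Site d) i) =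
      fun i => if i = j then gen N τ φ M j else 1 := by
    funext i
    by_cases hi : i = j
    · subst hi; simp
    · simp [hi]
  rw [h]
  have key : ∀ {n : ℕ} (j : Fin n) (g : unitary (UnivAlg N τ φ M)),
      (List.ofFn fun i => if i = j then g else 1).prod = g := by
    intro n
    induction n with
    | zero => exact fun j => j.elim0
    | succ n ih =>
      intro j g
      rw [List.ofFn_succ, List.prod_cons]
      refine Fin.cases ?_ (fun j => ?_) j
      · simp [Fin.succ_ne_zero, List.ofFn_const]
      · simp only [Fin.succ_inj, ih]
        simp [(Fin.succ_ne_zero j).symm]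
  exact key j _

variable (N τ φ M) in
/-- The unitaries that normalise the functions. -/
def funNormalizer : Subgroup (unitary (UnivAlg N τ φ M)) where
  carrier := {v | (∀ f, ∃ g, (v : UnivAlg N τ φ M) * ofFun N τ φ M f = ofFun N τ φ M g * v) ∧
    ∀ f, ∃ g, star (v : UnivAlg N τ φ M) * ofFun N τ φ M f =
      ofFun N τ φ M g * star (v : UnivAlg N τ φ M)}
  one_mem' := ⟨fun f => ⟨f, by simp⟩, fun f => ⟨f, by simp⟩⟩
  mul_mem' := by
    rintro v w ⟨hv, hv'⟩ ⟨hw, hw'⟩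
    constructor
    · intro f
      obtain ⟨g, hg⟩ := hw f
      obtain ⟨k, hk⟩ := hv g
      refine ⟨k, ?_⟩
      rw [Submonoid.coe_mul, mul_assoc, hg, ← mul_assoc, hk, mul_assoc]
    · intro f
      obtain ⟨g, hg⟩ := hv' f
      obtain ⟨k, hk⟩ := hw' g
      refine ⟨k, ?_⟩
      rw [Submonoid.coe_mul, star_mul, mul_assoc, hg, ← mul_assoc, hk, mul_assoc]
  inv_mem' := by
    rintro v ⟨hv, hv'⟩
    rw [← Unitary.star_eq_inv]
    refine ⟨fun f => ?_, fun f => ?_⟩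
    · rw [Unitary.coe_star]; exact hv' f
    · rw [Unitary.coe_star, star_star]; exact hv f

/-- The left inverse `σ` of `τ` lets functions cross `u_j` in both directions: `u_j f = (f ∘ σ_j)
u_j`. -/
theorem gen_mem_funNormalizer {σ : Fin d → C(X, X)}
    (hστ : ∀ j, (σ j).comp (τ j) = .id X) (j : Fin d) :
    gen N τ φ M j ∈ funNormalizer N τ φ M := by
  refine ⟨fun f => ⟨f.comp (σ j), ?_⟩, fun f => ⟨f.comp (τ j), ?_⟩⟩
  · have h := ofFun_mul_genElem (N := N) (τ := τ) (φ := φ) (M := M) (f.comp (σ j)) j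
    rw [ContinuousMap.comp_assoc, hστ, ContinuousMap.comp_id] at h
    exact h.symm
  · have h := ofFun_mul_genElem (N := N) (τ := τ) (φ := φ) (M := M) f j
    have h1 : star (genElem N τ φ M j) * genElem N τ φ M j = 1 :=
      Unitary.coe_star_mul_self (gen N τ φ M j)
    have h2 : genElem N τ φ M j * star (genElem N τ φ M j) = 1 :=
      Unitary.coe_mul_star_self (gen N τ φ M j)
    change star (genElem N τ φ M j) * ofFun N τ φ M f = _ * star (genElem N τ φ M j)
    calc star (genElem N τ φ M j) * ofFun N τ φ M f
        = star (genElem N τ φ M j) * (ofFun N τ φ M f * genElem N τ φ M j) *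
          star (genElem N τ φ M j) := by rw [mul_assoc, mul_assoc, h2, mul_one]
      _ = _ := by rw [h, ← mul_assoc, h1, one_mul]

theorem word_mem_funNormalizer {σ : Fin d → C(X, X)}
    (hστ : ∀ j, (σ j).comp (τ j) = .id X) (x : Site d) :
    word N τ φ M x ∈ funNormalizer N τ φ M := by
  refine Subgroup.list_prod_mem _ fun v hv => ?_
  obtain ⟨j, rfl⟩ := List.mem_ofFn.1 hv
  exact Subgroup.zpow_mem _ (gen_mem_funNormalizer hστ j) _

variable (N τ φ M) in
/-- The span of the elements `f u_y`, `y ∈ Y`. -/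
def spanOver (Y : Set (Site d)) : Submodule ℂ (UnivAlg N τ φ M) :=
  Submodule.span ℂ {a | ∃ f, ∃ y ∈ Y, a = ofFun N τ φ M f * word N τ φ M y}

theorem ofFun_mul_word_mem (f : MatFun N X) {Y : Set (Site d)} {y : Site d} (hy : y ∈ Y) :
    ofFun N τ φ M f * word N τ φ M y ∈ spanOver N τ φ M Y :=
  Submodule.subset_span ⟨f, y, hy, rfl⟩

theorem ofFun_mul_monomial_mem (f : MatFun N X) {Y : Set (Site d)} {y : Site d} (hy : y ∈ Y) :
    ofFun N τ φ M f * monomial N τ φ M y ∈ spanOver N τ φ M Y := by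
  obtain ⟨c, -, h⟩ := monomial_eq_smul_word (N := N) (τ := τ) (φ := φ) (M := M) y
  rw [h, mul_smul_comm]
  exact Submodule.smul_mem _ _ (ofFun_mul_word_mem f hy)

theorem spanOver_mono {Y Z : Set (Site d)} (h : Y ⊆ Z) :
    spanOver N τ φ M Y ≤ spanOver N τ φ M Z :=
  Submodule.span_mono fun _ ⟨f, y, hy, e⟩ => ⟨f, y, h hy, e⟩

theorem one_mem_spanOver {Y : Set (Site d)} (hY : 0 ∈ Y) : 1 ∈ spanOver N τ φ M Y := by
  have h := ofFun_mul_word_mem (N := N) (τ := τ) (φ := φ) (M := M) 1 hY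
  rwa [word_zero, map_one, one_mul] at h

/-- Supports add under multiplication, since words normalise the functions and multiply up to a
phase. -/
theorem mul_mem_spanOver {σ : Fin d → C(X, X)} (hστ : ∀ j, (σ j).comp (τ j) = .id X)
    {Y Z : Set (Site d)} {a b : UnivAlg N τ φ M} (ha : a ∈ spanOver N τ φ M Y)
    (hb : b ∈ spanOver N τ φ M Z) : a * b ∈ spanOver N τ φ M (Y + Z) := by
  have h : spanOver N τ φ M Y * spanOver N τ φ M Z ≤ spanOver N τ φ M (Y + Z) := by
    rw [spanOver, spanOver, Submodule.span_mul_span, Submodule.span_le]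
    rintro _ ⟨_, ⟨f, y, hy, rfl⟩, _, ⟨g, z, hz, rfl⟩, rfl⟩
    obtain ⟨k, hk⟩ := (word_mem_funNormalizer (N := N) (φ := φ) (M := M) hστ y).1 g
    obtain ⟨c, -, hc⟩ := word_mul_word (N := N) (τ := τ) (φ := φ) (M := M) y z
    have e : ofFun N τ φ M f * word N τ φ M y * (ofFun N τ φ M g * word N τ φ M z) =
        c • (ofFun N τ φ M (f * k) * word N τ φ M (y + z)) := by
      calc _ = ofFun N τ φ M f * (word N τ φ M y * ofFun N τ φ M g) * word N τ φ M z := by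
            simp only [mul_assoc]
        _ = ofFun N τ φ M f * ofFun N τ φ M k * (word N τ φ M y * word N τ φ M z) := by
            rw [hk]; simp only [mul_assoc]
        _ = _ := by rw [hc, map_mul, mul_smul_comm]
    change _ * _ ∈ _
    rw [e]
    exact Submodule.smul_mem _ _ (ofFun_mul_word_mem _ (Set.add_mem_add hy hz))
  exact h (Submodule.mul_mem_mul ha hb)

theorem star_mem_spanOver {σ : Fin d → C(X, X)} (hστ : ∀ j, (σ j).comp (τ j) = .id X)
    {Y : Set (Site d)} {a : UnivAlg N τ φ M} (ha : a ∈ spanOver N τ φ M Y) :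
    star a ∈ spanOver N τ φ M (-Y) := by
  induction ha using Submodule.span_induction with
  | mem a ha =>
    obtain ⟨f, y, hy, rfl⟩ := ha
    obtain ⟨k, hk⟩ := (word_mem_funNormalizer (N := N) (φ := φ) (M := M) hστ y).2 (star f)
    obtain ⟨c, -, hc⟩ := star_word (N := N) (τ := τ) (φ := φ) (M := M) y
    rw [star_mul, ← map_star, hk, hc, mul_smul_comm]
    exact Submodule.smul_mem _ _ (ofFun_mul_word_mem _ (Set.neg_mem_neg.2 hy))
  | zero => simp
  | add a b _ _ iha ihb => rw [star_add]; exact add_mem iha ihb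
  | smul c a _ ih => rw [star_smul]; exact Submodule.smul_mem _ _ ih

/-- The span is a `⋆`-subalgebra containing all generators, hence dense; once it is closed it is the
whole algebra. -/
theorem spanOver_univ_eq_top {σ : Fin d → C(X, X)} (hστ : ∀ j, (σ j).comp (τ j) = .id X)
    (hc : IsClosed (spanOver N τ φ M Set.univ : Set (UnivAlg N τ φ M))) (a : UnivAlg N τ φ M) :
    a ∈ spanOver N τ φ M Set.univ := by
  let K : StarSubalgebra ℂ (UnivAlg N τ φ M) :=
    { carrier := spanOver N τ φ M Set.univ
      mul_mem' := fun ha hb => spanOver_mono (Set.subset_univ _) (mul_mem_spanOver hστ ha hb)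
      add_mem' := fun ha hb => add_mem ha hb
      algebraMap_mem' := fun c => by
        rw [Algebra.algebraMap_eq_smul_one]
        exact Submodule.smul_mem _ _ (one_mem_spanOver (Set.mem_univ _))
      star_mem' := fun ha => spanOver_mono (Set.subset_univ _) (star_mem_spanOver hστ ha) }
  have hle : universalAlgebra N τ φ M ≤ K.map (universalAlgebra N τ φ M).subtype := by
    refine StarSubalgebra.topologicalClosure_minimal (StarAlgebra.adjoin_le ?_) ?_
    · rintro _ (⟨f, rfl⟩ | ⟨j, rfl⟩)
      · refine ⟨ofFun N τ φ M f, ?_, rfl⟩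
        have h := ofFun_mul_word_mem (N := N) (τ := τ) (φ := φ) (M := M) f
          (Set.mem_univ (0 : Site d))
        rwa [word_zero, Submonoid.coe_one, mul_one] at h
      · refine ⟨genElem N τ φ M j, ?_, rfl⟩
        have h := ofFun_mul_word_mem (N := N) (τ := τ) (φ := φ) (M := M) 1
          (Set.mem_univ (Pi.single j 1 : Site d))
        rw [word_single, map_one, one_mul] at h
        exact h
    · exact ((StarSubalgebra.isClosed_topologicalClosure _).isClosedEmbedding_subtypeVal).isClosedMap
        _ hc
  obtain ⟨b, hb, hab⟩ := hle a.2
  rwa [show a = b from Subtype.ext hab.symm]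

end Algebra

end Brillouin

/-! ### Weighted translations and block matrices over a finite group. -/

section WeightedShift

variable {n G : Type*} [Fintype n] [DecidableEq n] [AddCommGroup G] [Fintype G] [DecidableEq G]

/-- The weighted translation `(S ψ)(x) = p(x) ψ(x - t)` of functions on a finite group. -/
def weightedShift (t : G) (p : G → ℂ) : Matrix G G ℂ :=
  Matrix.of fun a b => if b = a - t then p a else 0

theorem weightedShift_mul (t s : G) (p q : G → ℂ) :
    weightedShift t p * weightedShift s q = weightedShift (t + s) fun x => p x * q (x - t) := by
  ext a b
  simp only [weightedShift, Matrix.mul_apply, Matrix.of_apply]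
  rw [Finset.sum_eq_single (a - t) (fun j _ hj => by simp [hj]) (by simp)]
  simp [sub_sub]

theorem weightedShift_one : weightedShift (0 : G) 1 = 1 := by
  ext a b
  simp [weightedShift, Matrix.one_apply, eq_comm]

theorem weightedShift_conjTranspose (t : G) (p : G → ℂ) :
    (weightedShift t p).conjTranspose = weightedShift (-t) fun x => star (p (x + t)) := by
  ext a b
  simp only [weightedShift, Matrix.conjTranspose_apply, Matrix.of_apply, sub_neg_eq_add]
  by_cases h : b = a + t
  · subst h; simp
  · rw [if_neg h, if_neg (fun h' => h (by rw [h']; abel)), star_zero]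

theorem weightedShift_pow (t : G) (p : G → ℂ) (hp : ∀ x, p (x - t) = p x) (k : ℕ) :
    weightedShift t p ^ k = weightedShift (k • t) fun x => p x ^ k := by
  have hp' : ∀ k : ℕ, ∀ x, p (x - k • t) = p x := by
    intro k
    induction k with
    | zero => simp
    | succ k ih => intro x; rw [succ_nsmul, ← sub_sub, hp, ih]
  induction k with
  | zero => simp [← weightedShift_one, Pi.one_def]
  | succ k ih =>
    rw [pow_succ, ih, weightedShift_mul, succ_nsmul]
    simp only [hp', pow_succ]

theorem one_kronecker_mul_star {S : Matrix G G ℂ} (h : S * S.conjTranspose = 1) :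
    ((1 : Matrix n n ℂ) ⊗ₖ S) * star ((1 : Matrix n n ℂ) ⊗ₖ S) = 1 := by
  rw [Matrix.star_eq_conjTranspose, Matrix.conjTranspose_kronecker, ← Matrix.mul_kronecker_mul, h]
  simp

theorem star_one_kronecker_mul {S : Matrix G G ℂ} (h : S.conjTranspose * S = 1) :
    star ((1 : Matrix n n ℂ) ⊗ₖ S) * ((1 : Matrix n n ℂ) ⊗ₖ S) = 1 := by
  rw [Matrix.star_eq_conjTranspose, Matrix.conjTranspose_kronecker, ← Matrix.mul_kronecker_mul, h]
  simp

theorem one_kronecker_pow (S : Matrix G G ℂ) (k : ℕ) :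
    ((1 : Matrix n n ℂ) ⊗ₖ S) ^ k = 1 ⊗ₖ (S ^ k) := by
  induction k with
  | zero => simp
  | succ k ih => rw [pow_succ, ih, ← Matrix.mul_kronecker_mul, pow_succ, one_mul]

theorem blockDiagonal_mul_one_kronecker_apply (F : G → Matrix n n ℂ) (t : G) (p : G → ℂ)
    (a b : n) (x y : G) :
    (Matrix.blockDiagonal F * ((1 : Matrix n n ℂ) ⊗ₖ weightedShift t p)) (a, x) (b, y) =
      if y = x - t then F x a b * p x else 0 := by
  simp only [Matrix.mul_apply, Fintype.sum_prod_type, Matrix.blockDiagonal_apply,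
    Matrix.kroneckerMap_apply, Matrix.one_apply, weightedShift, Matrix.of_apply]
  rw [Finset.sum_eq_single b (fun j _ hj => by simp [hj]) (by simp),
    Finset.sum_eq_single x (fun j _ hj => by simp [hj.symm]) (by simp)]
  simp

theorem one_kronecker_mul_blockDiagonal_apply (F : G → Matrix n n ℂ) (t : G) (p : G → ℂ)
    (a b : n) (x y : G) :
    (((1 : Matrix n n ℂ) ⊗ₖ weightedShift t p) * Matrix.blockDiagonal F) (a, x) (b, y) =
      if y = x - t then p x * F (x - t) a b else 0 := by
  simp only [Matrix.mul_apply, Fintype.sum_prod_type, Matrix.blockDiagonal_apply,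
    Matrix.kroneckerMap_apply, Matrix.one_apply, weightedShift, Matrix.of_apply]
  rw [Finset.sum_eq_single a (fun j _ hj => by simp [hj.symm]) (by simp),
    Finset.sum_eq_single y (fun j _ hj => by simp [hj]) (by simp)]
  by_cases h : y = x - t <;> simp [h]

/-- The matrix of `ℓ²`-blocks from the point `y` to the origin. -/
def originBlock (y : G) : Matrix (n × G) (n × G) ℂ →ₗ[ℂ] Matrix n n ℂ where
  toFun A := A.submatrix (·, 0) (·, y)
  map_add' _ _ := rfl
  map_smul' _ _ := rfl

theorem originBlock_blockDiagonal_mul (F : G → Matrix n n ℂ) (t : G) (p : G → ℂ) (y : G) :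
    originBlock y (Matrix.blockDiagonal F * ((1 : Matrix n n ℂ) ⊗ₖ weightedShift t p)) =
      if y = -t then p 0 • F 0 else 0 := by
  ext a b
  change (Matrix.blockDiagonal F * ((1 : Matrix n n ℂ) ⊗ₖ weightedShift t p)) (a, 0) (b, y) = _
  rw [blockDiagonal_mul_one_kronecker_apply, zero_sub]
  split_ifs <;> simp [mul_comm]

theorem norm_originBlock_le (y : G) (A : Matrix (n × G) (n × G) ℂ) : ‖originBlock y A‖ ≤ ‖A‖ := by
  -- `J x` is the isometric embedding of `ℂⁿ` at the point `x`; the block is the compression `J₀* A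
  -- J_y`.
  let J : G → Matrix (n × G) n ℂ := fun x => Matrix.of fun a b => if a = (b, x) then 1 else 0
  have hJ : ∀ x, ‖J x‖ ≤ 1 := by
    intro x
    have h : (J x).conjTranspose * J x = 1 := by
      ext a b
      simp [J, Matrix.mul_apply, Matrix.one_apply, eq_comm]
    have h1 := Matrix.l2_opNorm_conjTranspose_mul_self (J x)
    rw [h] at h1
    have h2 : ‖(1 : Matrix n n ℂ)‖ ≤ 1 := by
      cases subsingleton_or_nontrivial (Matrix n n ℂ)
      · rw [Subsingleton.elim (1 : Matrix n n ℂ) 0]; simp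
      · exact CStarRing.norm_one.le
    nlinarith [norm_nonneg (J x)]
  have e : originBlock y A = (J 0).conjTranspose * A * J y := by
    ext a b
    change A (a, 0) (b, y) = _
    simp [J, Matrix.mul_apply]
  rw [e]
  calc ‖(J 0).conjTranspose * A * J y‖ ≤ ‖(J 0).conjTranspose‖ * ‖A‖ * ‖J y‖ :=
        (Matrix.l2_opNorm_mul _ _).trans
          (mul_le_mul_of_nonneg_right (Matrix.l2_opNorm_mul _ _) (norm_nonneg _))
    _ ≤ 1 * ‖A‖ * 1 := by
        rw [Matrix.l2_opNorm_conjTranspose]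
        gcongr <;> exact hJ _
    _ = ‖A‖ := by ring

end WeightedShift

/-! ### The regular representation by magnetic translations of the torus. -/

namespace Brillouin

/-- The diagonal action of the functions on `ℂ^N ⊗ ℓ²` along a family of points. -/
def familyDiagonal (N : ℕ) {X G : Type*} [TopologicalSpace X] [Fintype G] [DecidableEq G]
    (F : G → X) : MatFun N X →⋆ₐ[ℂ] Matrix (Fin N × G) (Fin N × G) ℂ where
  toFun f := Matrix.blockDiagonal fun x => f (F x)
  map_one' := by
    rw [← Matrix.blockDiagonal_one]
    rfl
  map_mul' f g := by
    rw [← Matrix.blockDiagonal_mul]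
    rfl
  map_zero' := by
    rw [← Matrix.blockDiagonal_zero]
    rfl
  map_add' f g := by
    rw [← Matrix.blockDiagonal_add]
    rfl
  commutes' z := by
    ext ⟨a, x⟩ ⟨b, y⟩
    by_cases hx : x = y <;> by_cases ha : a = b <;>
      simp [Matrix.blockDiagonal_apply, Matrix.algebraMap_matrix_apply, hx, ha]
  map_star' f := by
    rw [Matrix.star_eq_conjTranspose, Matrix.blockDiagonal_conjTranspose]
    rfl

section Regular

variable {d : ℕ} {φ : Matrix (Fin d) (Fin d) ℝ} {L : ℕ}

/-- The Landau-gauge phase of the `j`-th magnetic translation of the torus with flux integers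
`m`. -/
def landauPhase (m : Fin d → Fin d → ℤ) (j : Fin d) (x : Torus d L) : ℂ :=
  ∏ k ∈ Finset.Iio j, ZMod.stdAddChar ((m j k : ZMod (2 * L + 1)) * x k)

theorem norm_landauPhase (m : Fin d → Fin d → ℤ) (j : Fin d) (x : Torus d L) :
    ‖landauPhase m j x‖ = 1 := by
  rw [landauPhase, norm_prod]
  exact Finset.prod_eq_one fun k _ => AddChar.norm_apply _ _

/-- A step in direction `i` changes only the factor `k = i`, which is present exactly when `i < j`.
-/
theorem landauPhase_sub (m : Fin d → Fin d → ℤ) (i j : Fin d) (x : Torus d L) :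
    landauPhase m j (x - Pi.single i 1) = landauPhase m j x *
      if i < j then ZMod.stdAddChar (-(m j i : ZMod (2 * L + 1))) else 1 := by
  unfold landauPhase
  have h : ∀ k, ZMod.stdAddChar ((m j k : ZMod (2 * L + 1)) * (x - Pi.single i 1 : Torus d L) k) =
      ZMod.stdAddChar ((m j k : ZMod (2 * L + 1)) * x k) *
        if i = k then ZMod.stdAddChar (-(m j i : ZMod (2 * L + 1))) else 1 := by
    intro k
    by_cases hk : i = k
    · subst hk
      rw [if_pos rfl, ← AddChar.map_add_eq_mul]
      congr 1
      simp; ring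
    · rw [if_neg hk]
      simp [Ne.symm hk]
  simp only [h, Finset.prod_mul_distrib, Finset.prod_ite_eq, Finset.mem_Iio]

/-- Flux quantisation makes `exp(i φ_ij)` a value of a character of `ℤ/(2L+1)`, so the phases are
well defined on the torus. -/
theorem stdAddChar_flux {m : Fin d → Fin d → ℤ}
    (hm : ∀ i j, φ i j = 2 * m i j * Real.pi / (2 * L + 1)) (i j : Fin d) :
    ZMod.stdAddChar (m i j : ZMod (2 * L + 1)) = Complex.exp (Complex.I * (φ i j : ℂ)) := by
  rw [ZMod.stdAddChar_coe, hm]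
  congr 1
  push_cast
  ring

/-- For `i ≠ j` exactly one of the two translations picks up a phase from the other; antisymmetry of
`φ` gives it the same value in both orders and settles the case `i = j`. -/
theorem landauPhase_comm (hφ : φ.transpose = -φ) {m : Fin d → Fin d → ℤ}
    (hm : ∀ i j, φ i j = 2 * m i j * Real.pi / (2 * L + 1)) (i j : Fin d) (x : Torus d L) :
    landauPhase m i x * landauPhase m j (x - Pi.single i 1) =
      Complex.exp (Complex.I * (φ i j : ℂ)) *
        (landauPhase m j x * landauPhase m i (x - Pi.single j 1)) := by
  have hij : φ i j = -φ j i := congrFun (congrFun hφ j) i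
  rw [landauPhase_sub, landauPhase_sub]
  rcases lt_trichotomy i j with h | rfl | h
  · rw [if_pos h, if_neg h.not_gt, AddChar.map_neg_eq_inv, stdAddChar_flux hm, hij,
      ← Complex.exp_neg]
    push_cast
    rw [mul_neg]
    ring
  · have : φ i i = 0 := by linarith
    simp [this]
  · rw [if_neg h.not_gt, if_pos h, AddChar.map_neg_eq_inv, stdAddChar_flux hm]
    have := Complex.exp_ne_zero (Complex.I * (φ i j : ℂ))
    field_simp

variable {N : ℕ} {Ω₀ : Type u} [TopologicalSpace Ω₀]

variable [CompactSpace Ω₀]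

/-- The representation of the finite-volume algebra on `ℂ^N ⊗ ℓ²` along the orbit of `ω`. -/
def regularRep [NeZero N] (hφ : φ.transpose = -φ) (m : Fin d → Fin d → ℤ)
    (hm : ∀ i j, φ i j = 2 * m i j * Real.pi / (2 * L + 1)) (ω : FiniteConfig d Ω₀ L) :
    CovariantRep N (finiteShiftGen d Ω₀ L) φ (2 * L + 1) where
  -- The torus is lifted so that the Hilbert space lies in the universe of `Ω₀`.
  H := EuclideanSpace ℂ (Fin N × ULift.{u} (Torus d L))
  π := (StarAlgEquiv.toStarAlgHom (Matrix.toEuclideanCLM (𝕜 := ℂ)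
    (n := Fin N × ULift.{u} (Torus d L)))).comp
      (familyDiagonal N fun x : ULift.{u} (Torus d L) => shift x.down ω)
  U j := Matrix.toEuclideanCLM (𝕜 := ℂ) (n := Fin N × ULift.{u} (Torus d L))
    (1 ⊗ₖ weightedShift (ULift.up (Pi.single j 1)) fun x => landauPhase m j x.down)
  U_mul_star j := by
    rw [← map_star, ← map_mul, one_kronecker_mul_star, map_one]
    rw [weightedShift_conjTranspose, weightedShift_mul, add_neg_cancel, ← weightedShift_one]
    congr 1
    funext x
    simp [Complex.mul_conj', norm_landauPhase]
  star_mul_U j := by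
    rw [← map_star, ← map_mul, star_one_kronecker_mul, map_one]
    rw [weightedShift_conjTranspose, weightedShift_mul, neg_add_cancel, ← weightedShift_one]
    congr 1
    funext x
    simp [Complex.conj_mul', norm_landauPhase]
  U_comm i j := by
    rw [← map_mul, ← map_mul, ← map_smul, ← Matrix.mul_kronecker_mul, ← Matrix.mul_kronecker_mul,
      weightedShift_mul, weightedShift_mul, ← Matrix.kronecker_smul]
    refine congrArg _ (congrArg _ ?_)
    ext a b
    simp only [weightedShift, Matrix.of_apply, Matrix.smul_apply, smul_eq_mul, mul_ite, mul_zero]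
    rw [add_comm (ULift.up (Pi.single j 1 : Torus d L))]
    split_ifs
    · exact landauPhase_comm hφ hm i j a.down
    · rfl
  covariant j f := by
    change Matrix.toEuclideanCLM (𝕜 := ℂ) (familyDiagonal N (fun x : ULift.{u} (Torus d L) => shift x.down ω) f) * _ =
      _ * Matrix.toEuclideanCLM (𝕜 := ℂ) (familyDiagonal N (fun x : ULift.{u} (Torus d L) => shift x.down ω)
      (f.comp (finiteShiftGen d Ω₀ L j)))
    rw [← map_mul, ← map_mul]
    congr 1
    ext ⟨a, x⟩ ⟨b, y⟩
    refine (blockDiagonal_mul_one_kronecker_apply _ _ _ _ _ _ _).trans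
      (Eq.trans ?_ (one_kronecker_mul_blockDiagonal_apply _ _ _ _ _ _ _).symm)
    refine if_congr Iff.rfl ((mul_comm _ _).trans (congrArg _ ?_)) rfl
    refine congrFun (congrFun (congrArg f ?_) a) b
    funext y
    change ω _ = ω _
    congr 1
    change y - x.down = y - Pi.single j 1 - (x.down - Pi.single j 1)
    abel
  periodic j := by
    -- The `j`-th phase involves only coordinates `k < j`, so it is constant along direction `j`.
    -- The power is then a translation by `(2L+1) e_j = 0`, weighted by `(2L+1)`-th powers of roots
    -- of unity.
    rw [← map_pow, one_kronecker_pow, weightedShift_pow]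
    · refine (congrArg _ (congrArg _ (Eq.trans (congrArg₂ _ ?_ ?_) weightedShift_one))).trans
        ((congrArg _ Matrix.one_kronecker_one).trans (map_one _))
      · apply ULift.down_injective
        funext i
        change (2 * L + 1) • (Pi.single j 1 : Torus d L) i = 0
        rw [nsmul_eq_mul, ZMod.natCast_self, zero_mul]
      · funext x
        rw [landauPhase, ← Finset.prod_pow]
        refine Finset.prod_eq_one fun k _ => ?_
        rw [← AddChar.map_nsmul_eq_pow, nsmul_eq_mul, ZMod.natCast_self, zero_mul,
          AddChar.map_zero_eq_one]
    · intro x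
      change landauPhase m j (x.down - Pi.single j 1) = _
      rw [landauPhase_sub, if_neg (lt_irrefl j), mul_one]

end Regular

end Brillouin

/-! ### Fourier coefficients in finite volume: norm bounds, uniqueness, existence. -/

namespace Brillouin

theorem finiteShiftGen_leftInverse {d L : ℕ} {Ω₀ : Type u} [TopologicalSpace Ω₀] (j : Fin d) :
    (shift (-Pi.single j 1)).comp (finiteShiftGen d Ω₀ L j) = .id (FiniteConfig d Ω₀ L) := by
  ext ω x
  change ω (_ - _ - _) = ω x
  congr 1
  abel

section Coefficients

variable {d N L : ℕ} {φ : Matrix (Fin d) (Fin d) ℝ} {Ω₀ : Type u} [TopologicalSpace Ω₀]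
  [CompactSpace Ω₀]

variable (N L φ Ω₀) in
/-- The finite-volume algebra without the Hausdorff assumption on the disorder space. -/
abbrev FinAlg : Type (u + 1) := UnivAlg N (finiteShiftGen d Ω₀ L) φ (2 * L + 1)

variable [NeZero N]

/-- The matrix of an element of the finite-volume algebra in the regular representation. -/
def regularMatrix (hφ : φ.transpose = -φ) (m : Fin d → Fin d → ℤ)
    (hm : ∀ i j, φ i j = 2 * m i j * Real.pi / (2 * L + 1)) (ω : FiniteConfig d Ω₀ L) :
    FinAlg N L φ Ω₀ →⋆ₐ[ℂ]
      Matrix (Fin N × ULift.{u} (Torus d L)) (Fin N × ULift.{u} (Torus d L)) ℂ :=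
  (StarAlgEquiv.toStarAlgHom (Matrix.toEuclideanCLM (𝕜 := ℂ)
    (n := Fin N × ULift.{u} (Torus d L))).symm).comp (evalRep (regularRep hφ m hm ω))

variable {hφ : φ.transpose = -φ} {m : Fin d → Fin d → ℤ}
  {hm : ∀ i j, φ i j = 2 * m i j * Real.pi / (2 * L + 1)} {ω : FiniteConfig d Ω₀ L}

theorem regularMatrix_ofFun (f : MatFun N (FiniteConfig d Ω₀ L)) :
    regularMatrix hφ m hm ω (ofFun N _ φ _ f) =
      Matrix.blockDiagonal fun x : ULift.{u} (Torus d L) => f (shift x.down ω) :=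
  (Matrix.toEuclideanCLM (𝕜 := ℂ) (n := Fin N × ULift.{u} (Torus d L))).symm_apply_apply _

theorem regularMatrix_gen (j : Fin d) :
    regularMatrix hφ m hm ω (gen N (finiteShiftGen d Ω₀ L) φ (2 * L + 1) j : FinAlg N L φ Ω₀) =
      1 ⊗ₖ weightedShift (ULift.up (Pi.single j 1)) fun x => landauPhase m j x.down :=
  (Matrix.toEuclideanCLM (𝕜 := ℂ) (n := Fin N × ULift.{u} (Torus d L))).symm_apply_apply _

theorem regularMatrix_word (y : Site d) :
    ∃ p : ULift.{u} (Torus d L) → ℂ, (∀ x, ‖p x‖ = 1) ∧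
      regularMatrix hφ m hm ω (word N (finiteShiftGen d Ω₀ L) φ (2 * L + 1) y : FinAlg N L φ Ω₀) =
        1 ⊗ₖ weightedShift (ULift.up (siteClass L y)) p := by
  -- The pairs of a unitary and a translation by which it acts with unimodular weights form a
  -- subgroup. It contains every `(u_j, e_j)`, hence the pair of a word and its class.
  let S : Subgroup (unitary (FinAlg N L φ Ω₀) × Multiplicative (ULift.{u} (Torus d L))) :=
    { carrier := {v | ∃ p : ULift.{u} (Torus d L) → ℂ, (∀ x, ‖p x‖ = 1) ∧
        regularMatrix hφ m hm ω (v.1 : FinAlg N L φ Ω₀) =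
          1 ⊗ₖ weightedShift v.2.toAdd p}
      one_mem' := by
        refine ⟨1, by simp, ?_⟩
        refine (map_one (regularMatrix hφ m hm ω)).trans ?_
        rw [Prod.snd_one, toAdd_one, weightedShift_one, Matrix.one_kronecker_one]
      mul_mem' := by
        rintro ⟨v, t⟩ ⟨w, s⟩ ⟨p, hp, hv⟩ ⟨q, hq, hw⟩
        refine ⟨fun x => p x * q (x - t.toAdd), by simp [hp, hq], ?_⟩
        refine (map_mul (regularMatrix hφ m hm ω) _ _).trans ?_
        rw [hv, hw, ← Matrix.mul_kronecker_mul, weightedShift_mul, one_mul]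
        rfl
      inv_mem' := by
        rintro ⟨v, t⟩ ⟨p, hp, hv⟩
        refine ⟨fun x => star (p (x + t.toAdd)), by simp [hp], ?_⟩
        refine (map_star (regularMatrix hφ m hm ω) _).trans ?_
        rw [hv, Matrix.star_eq_conjTranspose, Matrix.conjTranspose_kronecker,
          weightedShift_conjTranspose, Matrix.conjTranspose_one]
        rfl }
  let g : Fin d → unitary (FinAlg N L φ Ω₀) × Multiplicative (ULift.{u} (Torus d L)) :=
    fun j => (gen N (finiteShiftGen d Ω₀ L) φ (2 * L + 1) j,
      Multiplicative.ofAdd (ULift.up (Pi.single j 1)))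
  have hg : ∀ j, g j ∈ S := fun j =>
    ⟨fun x => landauPhase m j x.down, fun x => norm_landauPhase m j x.down, regularMatrix_gen j⟩
  have hmem : (List.ofFn fun j => g j ^ y j).prod ∈ S := by
    refine Subgroup.list_prod_mem _ fun v hv => ?_
    obtain ⟨j, rfl⟩ := List.mem_ofFn.1 hv
    exact Subgroup.zpow_mem _ (hg j) _
  have h1 : (List.ofFn fun j => g j ^ y j).prod.1 = word N (finiteShiftGen d Ω₀ L) φ _ y := by
    change MonoidHom.fst _ _ _ = _
    rw [map_list_prod, List.map_ofFn]
    rfl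
  have h2 : (List.ofFn fun j => g j ^ y j).prod.2 =
      Multiplicative.ofAdd (ULift.up (siteClass L y)) := by
    change MonoidHom.snd _ _ _ = _
    rw [map_list_prod, List.map_ofFn, List.prod_ofFn]
    have h3 : ∀ j, (MonoidHom.snd (unitary (FinAlg N L φ Ω₀)) _ ∘ fun j => g j ^ y j) j =
        Multiplicative.ofAdd (y j • ULift.up (Pi.single j 1 : Torus d L)) := fun j => rfl
    rw [Finset.prod_congr rfl fun j _ => h3 j, ← ofAdd_sum]
    congr 1
    apply ULift.down_injective
    have h4 := map_sum (AddEquiv.ulift : ULift.{u} (Torus d L) ≃+ Torus d L)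
      (fun j => y j • ULift.up (Pi.single j 1 : Torus d L)) Finset.univ
    refine h4.trans ?_
    funext i
    rw [Finset.sum_apply, Finset.sum_eq_single i]
    · change y i • (Pi.single i 1 : Torus d L) i = (y i : ZMod (2 * L + 1))
      simp
    · intro j _ hj
      change y j • (Pi.single j 1 : Torus d L) i = 0
      simp [hj.symm]
    · simp
  obtain ⟨p, hp, h⟩ := hmem
  rw [h1, h2] at h
  exact ⟨p, hp, h⟩

/-- The block of the regular representation that carries the coefficient at `x`. -/
def coeffBlock (hφ : φ.transpose = -φ) (m : Fin d → Fin d → ℤ)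
    (hm : ∀ i j, φ i j = 2 * m i j * Real.pi / (2 * L + 1)) (ω : FiniteConfig d Ω₀ L)
    (x : Torus d L) : FinAlg N L φ Ω₀ →ₗ[ℂ] Matrix (Fin N) (Fin N) ℂ :=
  (originBlock (-ULift.up x)).comp (regularMatrix hφ m hm ω).toAlgHom.toLinearMap

theorem norm_coeffBlock_le (x : Torus d L) (a : FinAlg N L φ Ω₀) :
    ‖coeffBlock hφ m hm ω x a‖ ≤ ‖a‖ :=
  (norm_originBlock_le _ _).trans (NonUnitalStarAlgHom.norm_apply_le (regularMatrix hφ m hm ω) a)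

/-- The coefficient is recovered only up to a phase, independent of the block, which is enough for
norms. -/
theorem coeffBlock_ofFun_mul_word (f : MatFun N (FiniteConfig d Ω₀ L)) (y : Site d) :
    ∃ c : ℂ, ‖c‖ = 1 ∧ ∀ x, coeffBlock hφ m hm ω x
      (ofFun N (finiteShiftGen d Ω₀ L) φ (2 * L + 1) f *
        (word N (finiteShiftGen d Ω₀ L) φ (2 * L + 1) y : FinAlg N L φ Ω₀)) =
        if siteClass L y = x then c • f ω else 0 := by
  obtain ⟨p, hp, h⟩ := regularMatrix_word (N := N) (hφ := hφ) (hm := hm) (ω := ω) y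
  refine ⟨p 0, hp 0, fun x => ?_⟩
  change originBlock _ (regularMatrix hφ m hm ω _) = _
  rw [map_mul, regularMatrix_ofFun, h, originBlock_blockDiagonal_mul]
  have e : shift (ULift.down (0 : ULift.{u} (Torus d L))) ω = ω := by
    funext z
    change ω (z - 0) = ω z
    rw [sub_zero]
  rw [e]
  refine if_congr ?_ rfl rfl
  rw [neg_inj]
  exact ⟨fun h => (congrArg ULift.down h).symm, fun h => congrArg ULift.up h.symm⟩

theorem coeffBlock_ofFun_mul_monomial (f : MatFun N (FiniteConfig d Ω₀ L)) (y : Site d) :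
    ∃ c : ℂ, ‖c‖ = 1 ∧ ∀ x, coeffBlock hφ m hm ω x
      (ofFun N (finiteShiftGen d Ω₀ L) φ (2 * L + 1) f * monomial N _ φ _ y) =
        if siteClass L y = x then c • f ω else 0 := by
  obtain ⟨b, hb, h⟩ := monomial_eq_smul_word (N := N) (τ := finiteShiftGen d Ω₀ L) (φ := φ)
    (M := 2 * L + 1) y
  obtain ⟨c, hc, h'⟩ := coeffBlock_ofFun_mul_word (hφ := hφ) (hm := hm) (ω := ω) f y
  refine ⟨b * c, by rw [norm_mul, hb, hc, one_mul], fun x => ?_⟩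
  rw [h, mul_smul_comm, map_smul, h', smul_ite, smul_smul, smul_zero]

theorem coeffBlock_eq_zero {Y : Set (Site d)} {x : Torus d L} (hx : ∀ y ∈ Y, siteClass L y ≠ x)
    {a : FinAlg N L φ Ω₀} (ha : a ∈ spanOver N (finiteShiftGen d Ω₀ L) φ (2 * L + 1) Y) :
    coeffBlock hφ m hm ω x a = 0 := by
  induction ha using Submodule.span_induction with
  | mem a ha =>
    obtain ⟨f, y, hy, rfl⟩ := ha
    obtain ⟨c, -, h⟩ := coeffBlock_ofFun_mul_word (hφ := hφ) (hm := hm) (ω := ω) f y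
    rw [h, if_neg (hx y hy)]
  | zero => exact map_zero _
  | add a b _ _ iha ihb => rw [map_add, iha, ihb, add_zero]
  | smul c a _ ih => rw [map_smul, ih, smul_zero]

theorem siteClass_injOn {x y : Site d} (hx : x ∈ superCell d L) (hy : y ∈ superCell d L)
    (h : siteClass L x = siteClass L y) : x = y := by
  funext i
  have h' : ((x i : ZMod (2 * L + 1))) = (y i : ZMod (2 * L + 1)) := congrFun h i
  rw [ZMod.intCast_eq_intCast_iff_dvd_sub] at h'
  obtain ⟨k, hk⟩ := h'
  have hx1 := (Finset.mem_Icc.1 hx).1 i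
  have hx2 := (Finset.mem_Icc.1 hx).2 i
  have hy1 := (Finset.mem_Icc.1 hy).1 i
  have hy2 := (Finset.mem_Icc.1 hy).2 i
  simp only at hx1 hx2 hy1 hy2
  push_cast at hk
  have hk0 : k = 0 := by
    by_contra hne
    rcases lt_or_gt_of_ne hne with h | h
    · nlinarith
    · nlinarith
  subst hk0
  omega

/-- Representatives in `V_L` have the smallest coordinates in their class, so an element supported
in a box cannot wrap around the torus and reach an `x` outside that box. -/
theorem natAbs_le_of_siteClass_eq {x y : Site d} (hx : x ∈ superCell d L)
    (h : siteClass L y = siteClass L x) (i : Fin d) : (x i).natAbs ≤ (y i).natAbs := by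
  refine ZMod.natAbs_min_of_le_div_two (2 * L + 1) _ _ (congrFun h i).symm ?_
  have hx1 := (Finset.mem_Icc.1 hx).1 i
  have hx2 := (Finset.mem_Icc.1 hx).2 i
  simp only at hx1 hx2
  omega

variable (N L φ Ω₀) in
omit [NeZero N] in
/-- The linear map that sums up a family of Fourier coefficients. -/
def fourierSum : (superCell d L → MatFun N (FiniteConfig d Ω₀ L)) →ₗ[ℂ] FinAlg N L φ Ω₀ where
  toFun c := ∑ x, ofFun N (finiteShiftGen d Ω₀ L) φ (2 * L + 1) (c x) * monomial N _ φ _ x.1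
  map_add' b c := by
    simp only [Pi.add_apply, map_add, add_mul, Finset.sum_add_distrib]
  map_smul' z c := by
    simp only [Pi.smul_apply, map_smul, smul_mul_assoc, Finset.smul_sum, RingHom.id_apply]

theorem coeffBlock_fourierSum (c : superCell d L → MatFun N (FiniteConfig d Ω₀ L))
    (x : superCell d L) :
    ‖coeffBlock hφ m hm ω (siteClass L x.1) (fourierSum N L φ Ω₀ c)‖ = ‖c x ω‖ := by
  have h : coeffBlock hφ m hm ω (siteClass L x.1) (fourierSum N L φ Ω₀ c) =
      ∑ y, coeffBlock hφ m hm ω (siteClass L x.1)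
        (ofFun N (finiteShiftGen d Ω₀ L) φ (2 * L + 1) (c y) * monomial N _ φ _ y.1) :=
    map_sum _ _ _
  rw [h, Finset.sum_eq_single x]
  · obtain ⟨b, hb, h⟩ := coeffBlock_ofFun_mul_monomial (hφ := hφ) (hm := hm) (ω := ω) (c x) x.1
    rw [h, if_pos rfl, norm_smul, hb, one_mul]
  · intro y _ hy
    obtain ⟨b, hb, h⟩ := coeffBlock_ofFun_mul_monomial (hφ := hφ) (hm := hm) (ω := ω) (c y) y.1
    rw [h, if_neg]
    exact fun h => hy (Subtype.ext (siteClass_injOn y.2 x.2 h))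
  · simp

/-- A Fourier coefficient at `x` is bounded by the distance to the elements that are supported
away from the class of `x`. -/
theorem norm_coeff_le (hφ : φ.transpose = -φ) (hL : FluxQuantized φ L)
    (c : superCell d L → MatFun N (FiniteConfig d Ω₀ L)) {Y : Set (Site d)} {x : superCell d L}
    (hx : ∀ y ∈ Y, siteClass L y ≠ siteClass L x.1) {p : FinAlg N L φ Ω₀}
    (hp : p ∈ spanOver N (finiteShiftGen d Ω₀ L) φ (2 * L + 1) Y) :
    ‖c x‖ ≤ ‖fourierSum N L φ Ω₀ c - p‖ := by
  choose m hm using hL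
  refine (ContinuousMap.norm_le _ (norm_nonneg _)).2 fun ω => ?_
  rw [← coeffBlock_fourierSum (hφ := hφ) (hm := hm) (φ := φ)]
  calc _ = ‖coeffBlock hφ m hm ω (siteClass L x.1) (fourierSum N L φ Ω₀ c - p)‖ := by
        rw [map_sub, coeffBlock_eq_zero hx hp, sub_zero]
    _ ≤ _ := norm_coeffBlock_le _ _

theorem norm_le_norm_fourierSum (hφ : φ.transpose = -φ) (hL : FluxQuantized φ L)
    (c : superCell d L → MatFun N (FiniteConfig d Ω₀ L)) :
    ‖c‖ ≤ ‖fourierSum N L φ Ω₀ c‖ := by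
  refine (pi_norm_le_iff_of_nonneg (norm_nonneg _)).2 fun x => ?_
  have h := norm_coeff_le hφ hL c (Y := ∅) (x := x) (p := 0) (by simp) (zero_mem _)
  rwa [sub_zero] at h

theorem fourierSum_injective (hφ : φ.transpose = -φ) (hL : FluxQuantized φ L) :
    Function.Injective (fourierSum N L φ Ω₀) := by
  refine (injective_iff_map_eq_zero _).2 fun c hc => ?_
  have h := norm_le_norm_fourierSum hφ hL c
  rw [hc, norm_zero] at h
  exact norm_le_zero_iff.1 h

omit [NeZero N] in
theorem range_fourierSum :
    LinearMap.range (fourierSum N L φ Ω₀) =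
      spanOver N (finiteShiftGen d Ω₀ L) φ (2 * L + 1) Set.univ := by
  refine le_antisymm ?_ (Submodule.span_le.2 ?_)
  · rintro _ ⟨c, rfl⟩
    exact Submodule.sum_mem _ fun x _ => ofFun_mul_monomial_mem _ (Set.mem_univ _)
  · rintro _ ⟨f, y, -, rfl⟩
    -- The relation `û_j^(2L+1) = 1` replaces every word by the one at the representative in `V_L`.
    have hw : word N (finiteShiftGen d Ω₀ L) φ (2 * L + 1) y =
        word N _ φ _ (siteLift (siteClass L y)) := by
      refine word_congr fun j => ?_
      rw [← ZMod.intCast_eq_intCast_iff_dvd_sub]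
      simp [siteLift, siteClass]
    obtain ⟨c, hc, h⟩ := monomial_eq_smul_word (N := N) (τ := finiteShiftGen d Ω₀ L) (φ := φ)
      (M := 2 * L + 1) (siteLift (siteClass L y))
    have hc0 : c ≠ 0 := by rintro rfl; simp at hc
    refine ⟨Pi.single ⟨_, siteLift_mem_superCell (siteClass L y)⟩ (c⁻¹ • f), ?_⟩
    change ∑ x, _ = _
    rw [Finset.sum_eq_single ⟨_, siteLift_mem_superCell (siteClass L y)⟩]
    · rw [Pi.single_eq_same, map_smul, h, hw, smul_mul_smul_comm, inv_mul_cancel₀ hc0, one_smul]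
    · intro x _ hx
      rw [Pi.single_eq_of_ne hx, map_zero, zero_mul]
    · simp

/-- The lower norm bound makes the range closed, and the range is the span of all `f u_y`. -/
theorem fourierSum_surjective (hφ : φ.transpose = -φ) (hL : FluxQuantized φ L) :
    Function.Surjective (fourierSum N L φ Ω₀) := by
  have hbound : ∀ c, ‖fourierSum N L φ Ω₀ c‖ ≤ (superCell d L).card * ‖c‖ := by
    intro c
    refine (norm_sum_le _ _).trans ((Finset.sum_le_card_nsmul _ _ ‖c‖ fun x _ => ?_).trans ?_)
    · refine (norm_mul_le _ _).trans ((mul_le_of_le_one_right (norm_nonneg _)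
        (norm_monomial_le _)).trans ((norm_ofFun_le _).trans (norm_le_pi_norm c x)))
    · simp
  have hclosed : IsClosed (LinearMap.range (fourierSum N L φ Ω₀) : Set (FinAlg N L φ Ω₀)) := by
    rw [LinearMap.coe_range]
    refine AntilipschitzWith.isClosed_range (K := 1) ?_
      (AddMonoidHomClass.uniformContinuous_of_bound (fourierSum N L φ Ω₀) _ hbound)
    refine AddMonoidHomClass.antilipschitz_of_bound (fourierSum N L φ Ω₀) fun c => ?_
    simpa using norm_le_norm_fourierSum hφ hL c
  rw [range_fourierSum] at hclosed
  intro a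
  have h := spanOver_univ_eq_top finiteShiftGen_leftInverse hclosed a
  rw [← range_fourierSum] at h
  exact h

end Coefficients

end Brillouin

/-! ### Resolvents of self-adjoint elements in a spectral gap. -/

section Resolvent

variable {A : Type*} [CStarAlgebra A]

/-- The spectrum is real, so moving `E` vertically cannot bring it closer. -/
theorem IsSelfAdjoint.le_norm_sub_of_gap {h : A} (hh : IsSelfAdjoint h) {E g : ℝ}
    (hgap : ∀ w ∈ spectrum ℂ h, g ≤ ‖w - E‖) (η : ℝ) {w : ℂ} (hw : w ∈ spectrum ℂ h) :
    g ≤ ‖w - (E + η * Complex.I)‖ := by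
  have h1 := hgap w hw
  rw [hh.mem_spectrum_eq_re hw, ← Complex.ofReal_sub, Complex.norm_real, Real.norm_eq_abs] at h1
  have h2 := Complex.abs_re_le_norm (w - (E + η * Complex.I))
  simp at h2
  exact h1.trans h2

theorem IsSelfAdjoint.cfc_sub_const {h : A} (hh : IsSelfAdjoint h) (z : ℂ) :
    cfc (fun w : ℂ => w - z) h = h - algebraMap ℂ A z := by
  have := hh.isStarNormal
  rw [cfc_sub (fun w : ℂ => w) (fun _ => z), cfc_id' ℂ h, cfc_const z h]

theorem IsSelfAdjoint.isUnit_sub_of_gap {h : A} (hh : IsSelfAdjoint h) {E g : ℝ} (hg : 0 < g)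
    (hgap : ∀ w ∈ spectrum ℂ h, g ≤ ‖w - E‖) (η : ℝ) :
    IsUnit (h - algebraMap ℂ A (E + η * Complex.I)) := by
  by_contra hu
  have hw : (E + η * Complex.I : ℂ) ∈ spectrum ℂ h := by
    rw [spectrum.mem_iff]
    intro hu'
    exact hu (by simpa using hu'.neg)
  have := hh.le_norm_sub_of_gap hgap η hw
  rw [sub_self, norm_zero] at this
  exact this.not_gt hg

theorem IsSelfAdjoint.norm_inverse_sub_le {h : A} (hh : IsSelfAdjoint h) {E g : ℝ} (hg : 0 < g)
    (hgap : ∀ w ∈ spectrum ℂ h, g ≤ ‖w - E‖) (η : ℝ) :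
    ‖Ring.inverse (h - algebraMap ℂ A (E + η * Complex.I))‖ ≤ g⁻¹ := by
  have := hh.isStarNormal
  have hbd := fun w hw => hh.le_norm_sub_of_gap hgap η (w := w) hw
  rw [← hh.cfc_sub_const, ← cfc_inv (fun w : ℂ => w - (E + η * Complex.I)) h fun w hw =>
    norm_pos_iff.1 (hg.trans_le (hbd w hw))]
  refine norm_cfc_le (inv_nonneg.2 hg.le) fun w hw => ?_
  rw [norm_inv]
  exact inv_anti₀ hg (hbd w hw)

/-- The element `1 - |h - z|² / (a² + η²)` for `z = E + iη`. -/
def resolventRemainder (h : A) (E η a : ℝ) : A :=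
  1 - (((a ^ 2 + η ^ 2)⁻¹ : ℝ) : ℂ) • ((h - algebraMap ℂ A (E + η * Complex.I)) *
    (h - algebraMap ℂ A (E - η * Complex.I)))

/-- On the spectrum `g² ≤ (t - E)² ≤ a²`, hence `0 ≤ 1 - ((t - E)² + η²)/(a² + η²) ≤ 1 - g²/a²`. The
`η²` in the normalisation makes the bound uniform in `η`. -/
theorem IsSelfAdjoint.norm_resolventRemainder_le {h : A} (hh : IsSelfAdjoint h) {E g a : ℝ}
    (hg : 0 < g) (hgap : ∀ w ∈ spectrum ℂ h, g ≤ ‖w - E‖) (hga : g ≤ a) (ha : ‖h‖ + |E| ≤ a)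
    (η : ℝ) : ‖resolventRemainder h E η a‖ ≤ 1 - g ^ 2 / a ^ 2 := by
  have ha0 : 0 < a := hg.trans_le hga
  have hq : 0 ≤ 1 - g ^ 2 / a ^ 2 := by
    rw [sub_nonneg, div_le_one (by positivity)]
    gcongr
  cases subsingleton_or_nontrivial A
  · rw [Subsingleton.elim (resolventRemainder h E η a) 0, norm_zero]; exact hq
  have := hh.isStarNormal
  have e : resolventRemainder h E η a = cfc (fun w : ℂ => 1 - (((a ^ 2 + η ^ 2)⁻¹ : ℝ) : ℂ) *
      ((w - (E + η * Complex.I)) * (w - (E - η * Complex.I)))) h := by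
    rw [cfc_sub (fun _ : ℂ => (1 : ℂ)) _ h, cfc_const_one ℂ h,
      cfc_const_mul _ (fun w : ℂ => (w - (E + η * Complex.I)) * (w - (E - η * Complex.I))) h,
      cfc_mul _ _ h, hh.cfc_sub_const, hh.cfc_sub_const]
    rfl
  rw [e]
  refine norm_cfc_le hq fun w hw => ?_
  have h1 := hgap w hw
  have h2 : ‖w‖ ≤ ‖h‖ := spectrum.norm_le_norm_of_mem hw
  rw [hh.mem_spectrum_eq_re hw] at h1 h2 ⊢
  rw [← Complex.ofReal_sub, Complex.norm_real, Real.norm_eq_abs] at h1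
  rw [Complex.norm_real, Real.norm_eq_abs] at h2
  set t := w.re
  have h3 : |t - E| ≤ a := (abs_sub t E).trans (by linarith)
  have e2 : (1 - (((a ^ 2 + η ^ 2)⁻¹ : ℝ) : ℂ) * (((t : ℂ) - (E + η * Complex.I)) *
      (t - (E - η * Complex.I)))) = ((1 - ((t - E) ^ 2 + η ^ 2) / (a ^ 2 + η ^ 2) : ℝ) : ℂ) := by
    have : ((t : ℂ) - (E + η * Complex.I)) * (t - (E - η * Complex.I)) =
        (t - E) ^ 2 + η ^ 2 := by
      linear_combination (-(η : ℂ) ^ 2) * Complex.I_sq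
    rw [this, div_eq_inv_mul]
    push_cast
    rfl
  rw [e2, Complex.norm_real, Real.norm_eq_abs]
  have hm : 0 < a ^ 2 + η ^ 2 := by positivity
  have h4 : g ^ 2 ≤ (t - E) ^ 2 := by rw [← sq_abs (t - E)]; gcongr
  have h5 : (t - E) ^ 2 ≤ a ^ 2 := by rw [← sq_abs (t - E)]; gcongr
  have h6 : g ^ 2 ≤ a ^ 2 := by gcongr
  rw [abs_of_nonneg]
  · rw [sub_le_sub_iff_left, div_le_div_iff₀ (by positivity) hm]
    nlinarith [mul_nonneg (sub_nonneg.2 h4) (sq_nonneg a), mul_nonneg (sub_nonneg.2 h6) (sq_nonneg η)]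
  · rw [sub_nonneg, div_le_one hm]
    linarith

/-- By the geometric sum `1 - Tⁿ` has the factor `1 - T`, a multiple of `(h - z)(h - z̄)`, whose
first factor cancels the resolvent. -/
theorem inverse_sub_inverse_mul_pow {h : A} {E η a : ℝ}
    (hu : IsUnit (h - algebraMap ℂ A (E + η * Complex.I))) (n : ℕ) :
    Ring.inverse (h - algebraMap ℂ A (E + η * Complex.I)) -
      Ring.inverse (h - algebraMap ℂ A (E + η * Complex.I)) * resolventRemainder h E η a ^ n =
      (((a ^ 2 + η ^ 2)⁻¹ : ℝ) : ℂ) • ((h - algebraMap ℂ A (E - η * Complex.I)) *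
        ∑ k ∈ Finset.range n, resolventRemainder h E η a ^ k) := by
  have h1 := mul_neg_geom_sum (resolventRemainder h E η a) n
  rw [← mul_one_sub, ← h1, resolventRemainder, sub_sub_cancel, ← mul_assoc, mul_smul_comm,
    ← mul_assoc, Ring.inverse_mul_cancel _ hu, one_mul, smul_mul_assoc]

/-- A gap of `h` at `E` persists under perturbations that are small relative to the resolvent. -/
theorem IsSelfAdjoint.gap_add {h δ : A} (hh : IsSelfAdjoint h) {E g θ : ℝ} (hg : 0 < g)
    (hgap : ∀ w ∈ spectrum ℂ h, g ≤ ‖w - E‖)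
    (hθ : ∀ η : ℝ, η ≠ 0 →
      ‖Ring.inverse (h - algebraMap ℂ A (E + η * Complex.I))‖ * ‖δ‖ ≤ θ) :
    ∀ w ∈ spectrum ℂ (h + δ), g * (1 - θ) ≤ ‖w - E‖ := by
  intro w hw
  by_contra! hlt
  cases subsingleton_or_nontrivial A
  · simp [spectrum.of_subsingleton] at hw
  -- The resolvent bound is available only off the real axis, so the expansion is made around `E +
  -- iη` with `η` small enough to keep the inequality strict.
  obtain ⟨η, hη0, hη⟩ : ∃ η : ℝ, 0 < η ∧ ‖w - E‖ + η < g * (1 - θ) :=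
    ⟨(g * (1 - θ) - ‖w - E‖) / 2, by linarith, by linarith⟩
  have hu := hh.isUnit_sub_of_gap hg hgap η
  have hR := hh.norm_inverse_sub_le hg hgap η
  have hRδ := hθ η hη0.ne'
  set z : ℂ := E + η * Complex.I
  set R := Ring.inverse (h - algebraMap ℂ A z)
  have hzw : ‖z - w‖ ≤ ‖w - E‖ + η := by
    have : z - w = -(w - E) + η * Complex.I := by simp only [z]; ring
    rw [this]
    refine (norm_add_le _ _).trans ?_
    rw [norm_neg, norm_mul, Complex.norm_I, mul_one, Complex.norm_real, Real.norm_of_nonneg hη0.le]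
  have hsmall : ‖-(R * (δ + algebraMap ℂ A (z - w)))‖ < 1 := by
    rw [norm_neg]
    calc ‖R * (δ + algebraMap ℂ A (z - w))‖ ≤ ‖R‖ * (‖δ‖ + ‖z - w‖) := by
          refine (norm_mul_le _ _).trans ?_
          gcongr
          refine (norm_add_le _ _).trans ?_
          rw [norm_algebraMap']
      _ = ‖R‖ * ‖δ‖ + ‖R‖ * ‖z - w‖ := mul_add _ _ _
      _ ≤ θ + g⁻¹ * (‖w - E‖ + η) := by gcongr
      _ < θ + g⁻¹ * (g * (1 - θ)) := by gcongr
      _ = 1 := by field_simp; ring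
  have hu2 := hu.mul (isUnit_one_sub_of_norm_lt_one hsmall)
  -- Neumann factorisation `h + δ - w = (h - z)(1 + R (δ + z - w))`; both factors are invertible,
  -- which contradicts `w` being in the spectrum.
  have e : (h - algebraMap ℂ A z) * (1 - -(R * (δ + algebraMap ℂ A (z - w)))) =
      h + δ - algebraMap ℂ A w := by
    rw [sub_neg_eq_add, mul_add, ← mul_assoc, Ring.mul_inverse_cancel _ hu, map_sub]
    simp only [mul_one, one_mul]
    abel
  rw [e] at hu2
  exact (spectrum.mem_iff.1 hw) (by simpa using hu2.neg)

end Resolvent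

/-- Turns the smallness condition on sums of `s`-th powers into one on the sums themselves. -/
theorem Real.rpow_sum_le {ι : Type*} (t : Finset ι) {f : ι → ℝ} (hf : ∀ i, 0 ≤ f i) {s : ℝ}
    (hs : 0 < s) (hs1 : s ≤ 1) : (∑ i ∈ t, f i) ^ s ≤ ∑ i ∈ t, f i ^ s := by
  classical
  induction t using Finset.induction_on with
  | empty => simp [hs.ne']
  | insert i t hi ih =>
    rw [Finset.sum_insert hi, Finset.sum_insert hi]
    refine (Real.rpow_add_le_add_rpow (hf i) (Finset.sum_nonneg fun j _ => hf j) hs.le hs1).trans ?_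
    gcongr

/-! ### Finite range and exponential decay of the resolvent coefficients. -/

namespace Brillouin

section FiniteRange

/-- The lattice points with coordinates of absolute value at most `k`. -/
def siteBox (d k : ℕ) : Set (Site d) := {y | ∀ i, (y i).natAbs ≤ k}

theorem siteBox_mono {d k l : ℕ} (h : k ≤ l) : siteBox d k ⊆ siteBox d l :=
  fun _ hy i => (hy i).trans h

theorem siteBox_add_subset (d k l : ℕ) : siteBox d k + siteBox d l ⊆ siteBox d (k + l) := by
  rintro _ ⟨x, hx, y, hy, rfl⟩ i
  exact (Int.natAbs_add_le _ _).trans (add_le_add (hx i) (hy i))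

theorem zero_mem_siteBox (d k : ℕ) : (0 : Site d) ∈ siteBox d k := fun _ => by simp

variable {X : Type u} [TopologicalSpace X] [CompactSpace X] {N d : ℕ} {τ σ : Fin d → C(X, X)}
  {φ : Matrix (Fin d) (Fin d) ℝ} {M : ℕ}

theorem mul_mem_spanOver_siteBox (hστ : ∀ j, (σ j).comp (τ j) = .id X) {k l : ℕ}
    {a b : UnivAlg N τ φ M} (ha : a ∈ spanOver N τ φ M (siteBox d k))
    (hb : b ∈ spanOver N τ φ M (siteBox d l)) :
    a * b ∈ spanOver N τ φ M (siteBox d (k + l)) :=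
  spanOver_mono (siteBox_add_subset d k l) (mul_mem_spanOver hστ ha hb)

theorem pow_mem_spanOver_siteBox (hστ : ∀ j, (σ j).comp (τ j) = .id X) {k : ℕ}
    {a : UnivAlg N τ φ M} (ha : a ∈ spanOver N τ φ M (siteBox d k)) (n : ℕ) :
    a ^ n ∈ spanOver N τ φ M (siteBox d (k * n)) := by
  induction n with
  | zero => rw [pow_zero]; exact one_mem_spanOver (zero_mem_siteBox d _)
  | succ n ih => rw [pow_succ, mul_add_one]; exact mul_mem_spanOver_siteBox hστ ih ha

theorem sub_algebraMap_mem_spanOver {k : ℕ} {a : UnivAlg N τ φ M}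
    (ha : a ∈ spanOver N τ φ M (siteBox d k)) (z : ℂ) :
    a - algebraMap ℂ _ z ∈ spanOver N τ φ M (siteBox d k) := by
  rw [Algebra.algebraMap_eq_smul_one]
  exact sub_mem ha (Submodule.smul_mem _ _ (one_mem_spanOver (zero_mem_siteBox d _)))

theorem resolvent_polynomial_mem_spanOver (hστ : ∀ j, (σ j).comp (τ j) = .id X) {r : ℕ}
    {h : UnivAlg N τ φ M} (hh : h ∈ spanOver N τ φ M (siteBox d r)) (c z : ℂ) (E η a : ℝ) (n : ℕ) :
    c • ((h - algebraMap ℂ _ z) * ∑ k ∈ Finset.range n, resolventRemainder h E η a ^ k) ∈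
      spanOver N τ φ M (siteBox d (2 * r * n)) := by
  refine Submodule.smul_mem _ _ ?_
  rw [Finset.mul_sum]
  refine Submodule.sum_mem _ fun k hk => ?_
  have hT : resolventRemainder h E η a ∈ spanOver N τ φ M (siteBox d (2 * r)) := by
    refine sub_mem (one_mem_spanOver (zero_mem_siteBox d _)) (Submodule.smul_mem _ _ ?_)
    rw [two_mul]
    exact mul_mem_spanOver_siteBox hστ (sub_algebraMap_mem_spanOver hh _)
      (sub_algebraMap_mem_spanOver hh _)
  refine spanOver_mono (siteBox_mono ?_) (mul_mem_spanOver_siteBox hστ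
    (sub_algebraMap_mem_spanOver hh _) (pow_mem_spanOver_siteBox hστ hT k))
  -- The range of the `k`-th term is `r + 2rk`, at most `2rn` because `k < n`.
  have := Nat.mul_le_mul_left (2 * r) (Nat.succ_le_of_lt (Finset.mem_range.1 hk))
  rw [Nat.succ_eq_add_one, mul_add_one] at this
  omega

end FiniteRange

/-- `k` is the largest absolute value of a coordinate, compared with the Euclidean length through
the `ℓ¹` norm. The alternative `k = 0` covers `d = 0`. -/
theorem exists_coordinate_bound {d : ℕ} (x : Site d) :
    ∃ k : ℕ, siteNorm x ≤ d * k ∧ (k = 0 ∨ ∃ i, k ≤ (x i).natAbs) := by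
  refine ⟨Finset.univ.sup fun i => (x i).natAbs, ?_, ?_⟩
  · have h : ∀ i, |(x i : ℝ)| ≤ (Finset.univ.sup fun i => (x i).natAbs : ℕ) := by
      intro i
      rw [← Int.cast_abs, Int.abs_eq_natAbs, Int.cast_natCast]
      exact_mod_cast Finset.le_sup (f := fun i => (x i).natAbs) (Finset.mem_univ i)
    calc siteNorm x ≤ ∑ i, |(x i : ℝ)| := by
          refine Real.sqrt_le_iff.2 ⟨Finset.sum_nonneg fun i _ => abs_nonneg _, ?_⟩
          simpa using Finset.sum_sq_le_sq_sum_of_nonneg (s := Finset.univ)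
            (f := fun i => |(x i : ℝ)|) fun i _ => abs_nonneg _
      _ ≤ ∑ _i : Fin d, ((Finset.univ.sup fun i => (x i).natAbs : ℕ) : ℝ) :=
          Finset.sum_le_sum fun i _ => h i
      _ = _ := by simp
  · rcases isEmpty_or_nonempty (Fin d) with hd | hd
    · left; simp
    · right
      obtain ⟨i, -, hi⟩ := Finset.exists_mem_eq_sup Finset.univ Finset.univ_nonempty
        fun i => (x i).natAbs
      exact ⟨i, hi.le⟩

section Decay

variable {d N L : ℕ} {φ : Matrix (Fin d) (Fin d) ℝ} {Ω₀ : Type u} [TopologicalSpace Ω₀]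
  [CompactSpace Ω₀] [NeZero N]

/-- Exponential decay of the Fourier coefficients of the resolvent in a spectral gap, with
constants that depend only on the gap, the norm and the range. -/
theorem norm_resolvent_coeff_le (hφ : φ.transpose = -φ) (hL : FluxQuantized φ L)
    {h : FinAlg N L φ Ω₀} (hh : IsSelfAdjoint h) {E g a : ℝ} (hg : 0 < g) (hga : g < a)
    (ha : ‖h‖ + |E| ≤ a) (hgap : ∀ w ∈ spectrum ℂ h, g ≤ ‖w - E‖) {r : ℕ}
    (hr : h ∈ spanOver N (finiteShiftGen d Ω₀ L) φ (2 * L + 1) (siteBox d r)) (η : ℝ)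
    {c : superCell d L → MatFun N (FiniteConfig d Ω₀ L)}
    (hc : fourierSum N L φ Ω₀ c = Ring.inverse (h - algebraMap ℂ _ (E + η * Complex.I)))
    (x : superCell d L) :
    ‖c x‖ ≤ g⁻¹ * Real.exp (-Real.log (1 - g ^ 2 / a ^ 2)) *
      Real.exp (-(-Real.log (1 - g ^ 2 / a ^ 2) / ((d + 1) * (2 * r + 1))) * siteNorm x.1) := by
  have ha0 : 0 < a := hg.trans hga
  have hq0 : 0 < 1 - g ^ 2 / a ^ 2 := by
    rw [sub_pos, div_lt_one (by positivity)]
    gcongr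
  have hq1 : 1 - g ^ 2 / a ^ 2 < 1 := by
    rw [sub_lt_self_iff]; positivity
  set q := 1 - g ^ 2 / a ^ 2
  set ℓ := -Real.log q
  have hℓ : 0 < ℓ := neg_pos.2 (Real.log_neg hq0 hq1)
  obtain ⟨k, hk1, hk2⟩ := exists_coordinate_bound x.1
  -- The largest power with `(2r+1) n ≤ k`. For `n ≥ 1` this forces `2rn < k`, so the polynomial
  -- part does not reach `x`.
  set n := k / (2 * r + 1)
  have hn1 : (2 * r + 1) * n ≤ k := Nat.mul_div_le _ _
  have hn2 : k < (2 * r + 1) * (n + 1) := Nat.lt_mul_div_succ _ (by omega)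
  have hu := hh.isUnit_sub_of_gap hg hgap η
  have hbound : ‖c x‖ ≤ g⁻¹ * q ^ n := by
    have hid := inverse_sub_inverse_mul_pow (a := a) hu n
    set p := (((a ^ 2 + η ^ 2)⁻¹ : ℝ) : ℂ) • ((h - algebraMap ℂ _ (E - η * Complex.I)) *
        ∑ k ∈ Finset.range n, resolventRemainder h E η a ^ k) with hp
    have hcp : ‖c x‖ ≤ ‖fourierSum N L φ Ω₀ c - p‖ := by
      -- For `n = 0` the polynomial vanishes and has empty support; the box of size `0` would not
      -- do, since `x` may be the origin.
      rcases Nat.eq_zero_or_pos n with hn | hn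
      · refine norm_coeff_le hφ hL c (Y := ∅) (by simp) ?_
        rw [hp, hn]
        simp
      · refine norm_coeff_le hφ hL c (Y := siteBox d (2 * r * n)) ?_
          (resolvent_polynomial_mem_spanOver finiteShiftGen_leftInverse hr _ _ E η a n)
        intro y hy hyx
        rcases hk2 with hk2 | ⟨i, hi⟩
        · have : n = 0 := by simp [n, hk2]
          omega
        · have h1 := natAbs_le_of_siteClass_eq x.2 hyx i
          have h2 := hy i
          have h3 : (2 * r + 1) * n = 2 * r * n + n := by ring
          omega
    refine hcp.trans ?_
    rw [hc, ← hid, sub_sub_cancel]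
    have hRn := hh.norm_inverse_sub_le hg hgap η
    have hTn := hh.norm_resolventRemainder_le hg hgap hga.le ha η
    rcases Nat.eq_zero_or_pos n with hn | hn
    · rw [hn, pow_zero, pow_zero, mul_one, mul_one]; exact hRn
    · refine (norm_mul_le _ _).trans ?_
      gcongr
      exact (norm_pow_le' _ hn).trans (pow_le_pow_left₀ (norm_nonneg _) hTn n)
  refine hbound.trans ?_
  rw [mul_assoc, ← Real.exp_add]
  refine mul_le_mul_of_nonneg_left ?_ (inv_nonneg.2 hg.le)
  have hqn : q ^ n = Real.exp (-(ℓ * n)) := by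
    rw [← Real.exp_log (pow_pos hq0 n), Real.log_pow]
    simp only [ℓ]
    ring_nf
  rw [hqn]
  refine Real.exp_le_exp.2 ?_
  -- Rounding in `n` costs one factor `1/q = exp ℓ`, the prefactor in the bound; `d + 1` replaces
  -- `d` to keep the rate defined for `d = 0`.
  have h1 : siteNorm x.1 ≤ (d + 1) * (2 * r + 1) * (n + 1) := by
    have : (k : ℝ) ≤ (2 * r + 1) * (n + 1) := by exact_mod_cast hn2.le
    calc siteNorm x.1 ≤ d * k := hk1
      _ ≤ (d + 1) * ((2 * r + 1) * (n + 1)) := by gcongr; linarith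
      _ = _ := by ring
  have h2 : ℓ / ((d + 1) * (2 * r + 1)) * siteNorm x.1 ≤ ℓ * (n + 1) := by
    rw [div_mul_eq_mul_div, div_le_iff₀ (by positivity)]
    nlinarith
  linarith

end Decay

end Brillouin

/-! ### From a uniform gap to the Aizenman–Molchanov bound. -/

namespace Brillouin

theorem inducedHom_monomial {X Y : Type u} [TopologicalSpace X] [TopologicalSpace Y]
    [CompactSpace X] [CompactSpace Y] (N : ℕ) {d : ℕ} {τ : Fin d → C(X, X)} {σ : Fin d → C(Y, Y)}
    (φ : Matrix (Fin d) (Fin d) ℝ) {M M' : ℕ} (F : C(Y, X))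
    (hF : ∀ j, F.comp (σ j) = (τ j).comp F) (hM : M' ∣ M) (x : Site d) :
    inducedHom N φ F hF hM (monomial N τ φ M x) = monomial N σ φ M' x := by
  rw [monomial, monomial, map_smul]
  congr 1
  let T : UnivAlg N τ φ M →⋆* UnivAlg N σ φ M' :=
    { toFun := inducedHom N φ F hF hM
      map_one' := map_one _
      map_mul' := map_mul _
      map_star' := map_star _ }
  have h : Unitary.map T (word N τ φ M x) = word N σ φ M' x := by
    rw [word, map_list_prod, List.map_ofFn, word]
    congr 2
    funext j
    exact map_zpow (Unitary.map T) (gen N τ φ M j) (x j)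
  exact congrArg Subtype.val h

section FiniteVolume

variable {d N : ℕ} {φ : Matrix (Fin d) (Fin d) ℝ} {Ω₀ : Type u} [TopologicalSpace Ω₀]
  [CompactSpace Ω₀] [T2Space Ω₀]

theorem norm_bulk_le (h : Site d →₀ MatFun N (Config d Ω₀)) {t : Finset (Site d)}
    (ht : h.support ⊆ t) {b : Site d → ℝ} (hb : ∀ x ∈ t, ‖h x‖ ≤ b x) :
    ‖bulk φ h‖ ≤ ∑ x ∈ t, b x := by
  rw [bulk, polynomial, Finsupp.sum_of_support_subset _ ht _ (by simp)]
  refine (norm_sum_le _ _).trans (Finset.sum_le_sum fun x hx => ?_)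
  exact (norm_mul_le _ _).trans ((mul_le_of_le_one_right (norm_nonneg _)
    (norm_monomial_le _)).trans ((norm_ofFun_le _).trans (hb x hx)))

theorem bulk_sub (f g : Site d →₀ MatFun N (Config d Ω₀)) :
    bulk φ (f - g) = bulk φ f - bulk φ g := by
  simp only [bulk, polynomial]
  exact Finsupp.sum_sub_index fun x a b => by rw [map_sub, sub_mul]

theorem finiteVolume_sub (L : ℕ) (a b : BulkAlgebra N Ω₀ φ) :
    finiteVolume φ L (a - b) = finiteVolume φ L a - finiteVolume φ L b := by
  simp only [finiteVolume, map_sub]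

theorem norm_finiteVolume_le (L : ℕ) (a : BulkAlgebra N Ω₀ φ) : ‖finiteVolume φ L a‖ ≤ ‖a‖ :=
  (NonUnitalStarAlgHom.norm_apply_le (periodicToFinite N Ω₀ φ L) _).trans
    (NonUnitalStarAlgHom.norm_apply_le (toPeriodic N Ω₀ φ L) _)

theorem isSelfAdjoint_finiteVolume {a : BulkAlgebra N Ω₀ φ} (ha : IsSelfAdjoint a) (L : ℕ) :
    IsSelfAdjoint (finiteVolume φ L a) :=
  (ha.map (toPeriodic N Ω₀ φ L)).map (periodicToFinite N Ω₀ φ L)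

/-- This makes the gap of `h₀` available in every volume with the same width. -/
theorem spectrum_finiteVolume_subset (L : ℕ) (a : BulkAlgebra N Ω₀ φ) :
    spectrum ℂ (finiteVolume φ L a) ⊆ spectrum ℂ a :=
  (AlgHom.spectrum_apply_subset (periodicToFinite N Ω₀ φ L) _).trans
    (AlgHom.spectrum_apply_subset (toPeriodic N Ω₀ φ L) _)

theorem infDist_le_of_mem_spectrum_finiteVolume (L : ℕ) {a : BulkAlgebra N Ω₀ φ} {E : ℂ} {w : ℂ}
    (hw : w ∈ spectrum ℂ (finiteVolume φ L a)) : Metric.infDist E (spectrum ℂ a) ≤ ‖w - E‖ := by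
  rw [← dist_eq_norm, dist_comm]
  exact Metric.infDist_le_dist_of_mem (spectrum_finiteVolume_subset L a hw)

theorem finiteVolume_bulk_mem_spanOver (L : ℕ) (h : Site d →₀ MatFun N (Config d Ω₀))
    {Y : Set (Site d)} (hY : ∀ x ∈ h.support, x ∈ Y) :
    finiteVolume φ L (bulk φ h) ∈ spanOver N (finiteShiftGen d Ω₀ L) φ (2 * L + 1) Y := by
  rw [bulk, polynomial, Finsupp.sum, finiteVolume, map_sum, map_sum]
  refine Submodule.sum_mem _ fun x hx => ?_
  rw [map_mul, map_mul, toPeriodic, periodicToFinite, inducedHom_monomial, inducedHom_monomial,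
    inducedHom_ofFun, inducedHom_ofFun]
  exact ofFun_mul_monomial_mem _ (hY x hx)

theorem exists_siteBox_superset (t : Finset (Site d)) : ∃ r, ∀ x ∈ t, x ∈ siteBox d r :=
  ⟨t.sup fun x => Finset.univ.sup fun i => (x i).natAbs, fun x hx i =>
    (Finset.le_sup (f := fun i => (x i).natAbs) (Finset.mem_univ i)).trans
      (Finset.le_sup (f := fun x : Site d => Finset.univ.sup fun i => (x i).natAbs) hx)⟩

variable [MeasurableSpace Ω₀]

theorem isProbabilityMeasure_finiteMeasure {P : Measure (Config d Ω₀)} [IsProbabilityMeasure P]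
    (L : ℕ) : IsProbabilityMeasure (finiteMeasure P L) :=
  have := Measure.isProbabilityMeasure_map (μ := P) (measurable_periodize L).aemeasurable
  Measure.isProbabilityMeasure_map (measurable_toFinite L).aemeasurable

/-- A spectral gap at `E` of the finite-volume approximations, uniform in the volume, implies the
Aizenman–Molchanov bound. -/
theorem aizenmanMolchanovBound_of_gap [NeZero N] (hφ : φ.transpose = -φ)
    {P : Measure (Config d Ω₀)} [IsProbabilityMeasure P]
    {h : Site d →₀ MatFun N (Config d Ω₀)} (hh : IsSelfAdjoint (bulk φ h)) {E g : ℝ} (hg : 0 < g)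
    (hgap : ∀ L, FluxQuantized φ L →
      ∀ w ∈ spectrum ℂ (finiteVolume φ L (bulk φ h)), g ≤ ‖w - E‖) {s : ℝ} (hs : 0 < s) :
    AizenmanMolchanovBound φ P h E s := by
  obtain ⟨r, hr⟩ := exists_siteBox_superset h.support
  -- The summands `g + 1` ensure `g < a`. Since `‖ĥ‖ ≤ ‖h‖`, this `a` serves all volumes, and the
  -- final constants do not depend on `L` or `η`.
  set a : ℝ := ‖bulk φ h‖ + |E| + g + 1 with ha
  have h0 : 0 ≤ ‖bulk φ h‖ := norm_nonneg _
  have h1 : 0 ≤ |E| := abs_nonneg _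
  have hga : g < a := by linarith
  have ha0 : 0 < a := hg.trans hga
  have hq0 : 0 < 1 - g ^ 2 / a ^ 2 := by
    rw [sub_pos, div_lt_one (by positivity)]
    gcongr
  have hq1 : 1 - g ^ 2 / a ^ 2 < 1 := by
    rw [sub_lt_self_iff]; positivity
  set ℓ := -Real.log (1 - g ^ 2 / a ^ 2) with hℓ'
  have hℓ : 0 < ℓ := neg_pos.2 (Real.log_neg hq0 hq1)
  set B := g⁻¹ * Real.exp ℓ with hB
  have hB0 : 0 < B := by positivity
  refine ⟨B ^ s, by positivity, ℓ / ((d + 1) * (2 * r + 1)) * s, by positivity, ?_⟩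
  intro L hL η _
  have hhL := isSelfAdjoint_finiteVolume hh L
  refine ⟨hhL.isUnit_sub_of_gap hg (hgap L hL) η, ?_⟩
  obtain ⟨G, hG⟩ := fourierSum_surjective hφ hL
    (finiteResolvent φ L (finiteVolume φ L (bulk φ h)) (E + η * Complex.I))
  refine ⟨G, fun G' => ⟨fun h' => fourierSum_injective hφ hL ?_, fun h' => ?_⟩, fun x => ?_⟩
  · exact Eq.trans (Eq.symm h') hG.symm
  · rw [h']; exact hG.symm
  · have hGx := norm_resolvent_coeff_le hφ hL hhL hg hga
      (by linarith [norm_finiteVolume_le L (bulk φ h)]) (hgap L hL)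
      (finiteVolume_bulk_mem_spanOver L h hr) η hG x
    have := isProbabilityMeasure_finiteMeasure (P := P) L
    -- The decay holds in supremum norm, so the integrand is bounded by a constant and the total
    -- mass is one.
    have hle : ∀ ω, ‖‖G x ω‖ ^ s‖ ≤
        B ^ s * Real.exp (-(ℓ / ((d + 1) * (2 * r + 1)) * s) * siteNorm x.1) := by
      intro ω
      rw [Real.norm_of_nonneg (by positivity)]
      refine (Real.rpow_le_rpow (norm_nonneg _) (((G x).norm_coe_le_norm ω).trans hGx)
        hs.le).trans_eq ?_
      rw [Real.mul_rpow hB0.le (Real.exp_pos _).le, ← Real.exp_mul]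
      congr 2
      ring
    refine (le_abs_self _).trans ?_
    have hint := norm_integral_le_of_norm_le_const (μ := finiteMeasure P L)
      (Filter.Eventually.of_forall hle)
    simpa using hint

end FiniteVolume

theorem subsingleton_univAlg {X : Type u} [TopologicalSpace X] [CompactSpace X] {d : ℕ}
    (τ : Fin d → C(X, X)) (φ : Matrix (Fin d) (Fin d) ℝ) (M : ℕ) :
    Subsingleton (UnivAlg 0 τ φ M) := by
  refine subsingleton_of_zero_eq_one ?_
  rw [← map_zero (ofFun 0 τ φ M), ← map_one (ofFun 0 τ φ M)]
  congr 1
  ext ω i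
  exact i.elim0

theorem mem_superCell_of_siteNorm_le {d : ℕ} {x : Site d} {R : ℝ} (hx : siteNorm x ≤ R) :
    x ∈ superCell d ⌈R⌉₊ := by
  have h : ∀ i, |x i| ≤ (⌈R⌉₊ : ℤ) := by
    intro i
    have h1 : |(x i : ℝ)| ≤ siteNorm x :=
      Real.abs_le_sqrt (Finset.single_le_sum (f := fun i => (x i : ℝ) ^ 2)
        (fun j _ => sq_nonneg _) (Finset.mem_univ i))
    have h2 := (h1.trans hx).trans (Nat.le_ceil R)
    exact_mod_cast h2
  exact Finset.mem_Icc.2 ⟨fun i => (abs_le.1 (h i)).1, fun i => (abs_le.1 (h i)).2⟩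

/-! ### Small perturbations of `h₀` and the two smallness conditions. -/

section Perturbation

variable {d N : ℕ} {φ : Matrix (Fin d) (Fin d) ℝ} {Ω₀ : Type u} [TopologicalSpace Ω₀]
  [CompactSpace Ω₀] [T2Space Ω₀] [MeasurableSpace Ω₀]

/-- Common core of both assertions: the perturbed finite-volume operators keep a gap `g (1 - θ)`,
with `g` the distance from `E` to the spectrum of `h₀`. -/
theorem aizenmanMolchanovBound_of_norm_mul_le [NeZero N] (hφ : φ.transpose = -φ)
    {P : Measure (Config d Ω₀)} [IsProbabilityMeasure P]
    {h₀ h : Site d →₀ MatFun N (Config d Ω₀)} (hh₀ : IsSelfAdjoint (bulk φ h₀))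
    (hh : IsSelfAdjoint (bulk φ h)) {E : ℝ}
    (hE : 0 < Metric.infDist (E : ℂ) (spectrum ℂ (bulk φ h₀))) {θ : ℝ} (hθ : θ < 1)
    (hle : ∀ L, FluxQuantized φ L → ∀ η : ℝ, η ≠ 0 →
      ‖finiteResolvent φ L (finiteVolume φ L (bulk φ h₀)) (E + η * Complex.I)‖ *
        ‖bulk φ (h - h₀)‖ ≤ θ) {s : ℝ} (hs : 0 < s) :
    AizenmanMolchanovBound φ P h E s := by
  refine aizenmanMolchanovBound_of_gap hφ hh (mul_pos hE (sub_pos.2 hθ)) (fun L hL => ?_) hs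
  have e : finiteVolume φ L (bulk φ h) =
      finiteVolume φ L (bulk φ h₀) + finiteVolume φ L (bulk φ (h - h₀)) := by
    rw [bulk_sub, finiteVolume_sub, add_sub_cancel]
  rw [e]
  refine (isSelfAdjoint_finiteVolume hh₀ L).gap_add hE (fun w hw => infDist_le_of_mem_spectrum_finiteVolume L hw)
    fun η hη => ?_
  exact (mul_le_mul_of_nonneg_left (norm_finiteVolume_le L _) (norm_nonneg _)).trans (hle L hL η hη)

end Perturbation

end Brillouin

namespace Brillouin

theorem norm_fourierSum_le {d N L : ℕ} {φ : Matrix (Fin d) (Fin d) ℝ} {Ω₀ : Type u}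
    [TopologicalSpace Ω₀] [CompactSpace Ω₀]
    (c : superCell d L → MatFun N (FiniteConfig d Ω₀ L)) :
    ‖fourierSum N L φ Ω₀ c‖ ≤ ∑ x, ‖c x‖ := by
  refine (norm_sum_le _ _).trans (Finset.sum_le_sum fun x _ => ?_)
  exact (norm_mul_le _ _).trans ((mul_le_of_le_one_right (norm_nonneg _)
    (norm_monomial_le _)).trans (norm_ofFun_le _))

theorem norm_sub_constCoeff_le {d N : ℕ} {X : Type u} [TopologicalSpace X] [CompactSpace X]
    {h : Site d →₀ MatFun N X} {w : Site d →₀ Matrix (Fin N) (Fin N) ℂ} {ω₀ : X}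
    (hω : ∀ x, h x ω₀ = w x) (x : Site d) {C : ℝ} (hC : 0 ≤ C) (hle : ∀ ω, ‖h x ω - h x ω₀‖ ≤ C) :
    ‖(h - constCoeff X w) x‖ ≤ C := by
  refine (ContinuousMap.norm_le _ hC).2 fun ω => ?_
  rw [Finsupp.sub_apply, constCoeff, Finsupp.mapRange_apply, ContinuousMap.sub_apply,
    ContinuousMap.const_apply, ← hω x]
  exact hle ω

end Brillouin

end

theorem mainTheorem6 {d N : ℕ} {Ω₀ : Type*}
    [TopologicalSpace Ω₀] [CompactSpace Ω₀] [TopologicalSpace.MetrizableSpace Ω₀]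
    [MeasurableSpace Ω₀] [BorelSpace Ω₀]
    (P : Measure (Config d Ω₀)) (hP : IsDisorderMeasure P)
    (φ : Matrix (Fin d) (Fin d) ℝ) (hφ : φ.transpose = -φ)
    (ω₀ : Config d Ω₀) (hω₀ : ∀ y : Site d, shift y ω₀ = ω₀)
    (R : ℝ) (w : Site d →₀ Matrix (Fin N) (Fin N) ℂ) (hw : ∀ x, R < siteNorm x → w x = 0)
    (hw_sa : IsSelfAdjoint (bulk φ (constCoeff (Config d Ω₀) w)))
    (E : ℝ)
    (hE : 0 < Metric.infDist (E : ℂ) (spectrum ℂ (bulk φ (constCoeff (Config d Ω₀) w)))) :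
    (∃ ε : ℝ, 0 < ε ∧
      ∀ h : Site d →₀ MatFun N (Config d Ω₀),
        IsSelfAdjoint (bulk φ h) →
        (∀ x, R < siteNorm x → h x = 0) →
        (∀ x, h x ω₀ = w x) →
        (∀ x ω, ‖h x ω - h x ω₀‖ ≤ ε) →
        ∀ s ∈ Set.Ioo (0 : ℝ) 1, AizenmanMolchanovBound φ P h E s) ∧
    (∀ h : Site d →₀ MatFun N (Config d Ω₀),
        IsSelfAdjoint (bulk φ h) →
        (∀ x, R < siteNorm x → h x = 0) →
        (∀ x, h x ω₀ = w x) →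
        ∀ s ∈ Set.Ioo (0 : ℝ) 1,
          (∃ θ : ℝ, θ < 1 ∧ ∀ L : ℕ, FluxQuantized φ L → ∀ η : ℝ, η ≠ 0 →
            ∀ G : superCell d L → MatFun N (FiniteConfig d Ω₀ L),
              IsFourierExpansion φ L
                (finiteResolvent φ L
                  (finiteVolume φ L (bulk φ (constCoeff (Config d Ω₀) w)))
                  (E + η * Complex.I)) G →
              (∑ x, ‖G x‖ ^ s) * (∑ x ∈ h.support, (⨆ ω, ‖h x ω - h x ω₀‖) ^ s) ≤ θ) →
          AizenmanMolchanovBound φ P h E s) := by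
  have : IsProbabilityMeasure P := hP.isProbability
  -- For `N = 0` the algebra is trivial and its spectrum empty; the distance to it is then `0` by
  -- convention, contrary to `hE`.
  have : NeZero N := by
    refine ⟨?_⟩
    rintro rfl
    have := subsingleton_univAlg (shiftGen d Ω₀) φ 0
    rw [spectrum.of_subsingleton, Metric.infDist_empty] at hE
    exact lt_irrefl _ hE
  set g := Metric.infDist (E : ℂ) (spectrum ℂ (bulk φ (constCoeff (Config d Ω₀) w))) with hg
  -- At most `card` sites lie within the range, so `‖h - h₀‖ ≤ g/2` and the product with `‖(ĥ₀ -
  -- z)⁻¹‖ ≤ 1/g` is at most `1/2`. The box depends on `R` alone, so `ε` does not depend on `h`.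
  refine ⟨⟨g / 2 / ((superCell d ⌈R⌉₊).card + 1), by positivity, ?_⟩, ?_⟩
  · intro h hsa hR hω hε s hs
    refine aizenmanMolchanovBound_of_norm_mul_le hφ hw_sa hsa hE one_half_lt_one
      (fun L _ η _ => ?_) hs.1
    have hres := (isSelfAdjoint_finiteVolume hw_sa L).norm_inverse_sub_le hE
      (fun v hv => infDist_le_of_mem_spectrum_finiteVolume L hv) η
    have hsupp : (h - constCoeff (Config d Ω₀) w).support ⊆ superCell d ⌈R⌉₊ := by
      intro x hx
      refine mem_superCell_of_siteNorm_le (not_lt.1 fun hlt => Finsupp.mem_support_iff.1 hx ?_)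
      rw [Finsupp.sub_apply, hR x hlt, constCoeff, Finsupp.mapRange_apply, hw x hlt, zero_sub,
        neg_eq_zero]
      rfl
    have hδ : ‖bulk φ (h - constCoeff (Config d Ω₀) w)‖ ≤ g / 2 := by
      refine (norm_bulk_le _ hsupp (b := fun _ => g / 2 / ((superCell d ⌈R⌉₊).card + 1))
        fun x _ => norm_sub_constCoeff_le hω x (by positivity) (hε x)).trans ?_
      rw [Finset.sum_const, nsmul_eq_mul, mul_div_assoc', div_le_iff₀ (by positivity)]
      nlinarith
    calc _ ≤ g⁻¹ * (g / 2) := mul_le_mul hres hδ (norm_nonneg _) (inv_nonneg.2 hE.le)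
      _ = 1 / 2 := by field_simp
  · rintro h hsa - hω s hs ⟨θ, hθ, hbound⟩
    refine aizenmanMolchanovBound_of_norm_mul_le hφ hw_sa hsa hE
      -- The hypothesis bounds the `s`-th power of the norm product, whence the exponent `1/s`. A
      -- negative `θ` can occur only if no `L` is admissible, and the maximum keeps the real power
      -- well behaved.
      (θ := max θ 0 ^ s⁻¹) (Real.rpow_lt_one (le_max_right _ _) (max_lt hθ one_pos)
        (inv_pos.2 hs.1)) (fun L hL η hη => ?_) hs.1
    obtain ⟨G, hG⟩ := fourierSum_surjective hφ hL
      (finiteResolvent φ L (finiteVolume φ L (bulk φ (constCoeff (Config d Ω₀) w)))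
        (E + η * Complex.I))
    have hθG := hbound L hL η hη G hG.symm
    have hres : ‖finiteResolvent φ L (finiteVolume φ L (bulk φ (constCoeff (Config d Ω₀) w)))
        (E + η * Complex.I)‖ ≤ ∑ x, ‖G x‖ := by
      rw [← hG]
      exact norm_fourierSum_le G
    have hD : ∀ x, 0 ≤ ⨆ ω, ‖h x ω - h x ω₀‖ := fun x => Real.iSup_nonneg fun ω => norm_nonneg _
    have hsupp : (h - constCoeff (Config d Ω₀) w).support ⊆ h.support := by
      intro x hx
      rw [Finsupp.mem_support_iff] at hx ⊢
      intro hx0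
      refine hx ?_
      rw [Finsupp.sub_apply, hx0, constCoeff, Finsupp.mapRange_apply, ← hω x, hx0, zero_sub,
        neg_eq_zero]
      rfl
    have hδ : ‖bulk φ (h - constCoeff (Config d Ω₀) w)‖ ≤
        ∑ x ∈ h.support, ⨆ ω, ‖h x ω - h x ω₀‖ := by
      refine norm_bulk_le _ hsupp fun x _ => norm_sub_constCoeff_le hω x (hD x) fun ω => ?_
      -- Compactness of `Ω` makes the fluctuation bounded, so the real supremum is a genuine upper
      -- bound.
      exact le_ciSup (f := fun ω => ‖h x ω - h x ω₀‖)
        (isCompact_range (by fun_prop)).bddAbove ω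
    refine (mul_le_mul hres hδ (norm_nonneg _) (Finset.sum_nonneg fun x _ => norm_nonneg _)).trans
      ?_
    have hS := Finset.sum_nonneg (s := Finset.univ) fun x _ => norm_nonneg (G x)
    have hS' := Finset.sum_nonneg (s := h.support) fun x _ => hD x
    rw [Real.le_rpow_inv_iff_of_pos (mul_nonneg hS hS') (le_max_right _ _) hs.1,
      Real.mul_rpow hS hS']
    refine (mul_le_mul (Real.rpow_sum_le _ (fun x => norm_nonneg _) hs.1 hs.2.le)
      (Real.rpow_sum_le _ hD hs.1 hs.2.le) (Real.rpow_nonneg hS' _)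
      (Finset.sum_nonneg fun x _ => Real.rpow_nonneg (norm_nonneg _) _)).trans
      (hθG.trans (le_max_left _ _))
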